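/- **Theorem (Iterative Smooth Call Prices).** For spot $s>0$, strike $k\ge 0$ and total variance $v\ge 0$ let $\mathrm{Call}(s,k,v)=s\,\mathcal N(d_+)-k\,\mathcal N(d_-)$, $d_\pm=\frac{-\ln(k/s)\pm v/2}{\sqrt v}$, be the Black–Scholes call price, where $\mathcal N$ is the standard normal distribution function; for $v=0$ or $k=0$ this is read as its limit $(s-k)^+$. A surface $C:[0,\infty)^2\to[0,\infty)$ is *arbitrage-free* if there are a probability measure and an a.s. positive martingale $(Z_T)_{T\ge0}$ with $Z_0=1$ a.s. and $C(T,K)=\mathbb E[(Z_T-K)^+]$ for all $T,K\ge0$. It is *smooth at time $T$* if $\partial_{KK}C(T,K)>0$ for all $K>0$, where derivatives in $K$ are right-hand derivatives (and are claimed to exist). Let $M\ge1$, $0<K^1<\dots<K^N$, $0=T_0<T_1<\dots<T_M$, and let $\alpha_j:[T_j,T_{j+1}]\to[0,1]$, $j=0,\dots,M-1$, be non-decreasing with $\alpha_j(T_j)=0$ and $\alpha_j(T_{j+1})=1$. Let $dV_j^i\ge0$ and $q_j^i\ge 0$ ($1\le i\le N$, $1\le j\le M$) with $\sum_i q_j^i=1$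 and $\sum_i q_j^iK^i=1$ for every $j$ (the $q_j$ need not form a martingale density). Define $$\tilde c_1(K;v)=\sum_{i=1}^N q_1^i\,\mathrm{Call}(K^i,K,dV_1^i+v),\qquad \tilde c_j(K;v)=\sum_{i=1}^N q_j^i\,K^i\,\tilde c_{j-1}\!\left(\tfrac{K}{K^i};\,dV_j^i+v\right)\quad(2\le j\le M),$$ $\tilde C_0(K)=(1-K)^+$, $\tilde C_j(K)=\tilde c_j(K;0)$ for $1\le j\le M$, and $$\tilde C(T,K)=\alpha_j(T)\,\tilde C_{j+1}(K)+(1-\alpha_j(T))\,\tilde C_j(K)\quad\text{for }T\in[T_j,T_{j+1}),\qquad \tilde C(T,K)=\tilde C_M(K)\quad\text{for }T\ge T_M .$$ Then: 1. $\tilde C$ is arbitrage-free. 2. If $q_1^i>0$ and $dV_1^i>0$ for at least one $i$, then $\tilde C$ is smooth at every time $T\ge T_1$ and at every $T\in(0,T_1)$ with $\alpha_0(T)>0$ (so at every $T>0$ if $\alpha_0$ is strictly increasing). If $dV_1^i>0$ for every $i$ with $q_1^i>0$, then moreover $K\mapsto\tilde C(T,K)$ is $C^\infty$ on $(0,\infty)$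 for every $T\ge T_1$. 3. There are a probability space and, on it, independent random variables $X_\ell$ and $N_\ell^i$ ($1\le\ell\le M$, $1\le i\le N$) with $\mathbb P[X_\ell=K^i]=q_\ell^i$ and $N_\ell^i$ standard normal. For any such variables put $Y_\ell^i=\exp(\sqrt{dV_\ell^i}\,N_\ell^i-\tfrac12dV_\ell^i)$ and $Z_j=\prod_{\ell=1}^jX_\ell\,Y_\ell^{X_\ell}$ for $0\le j\le M$, where $Y_\ell^{X_\ell}$ denotes $Y_\ell^i$ on $\{X_\ell=K^i\}$. Then $(Z_j)_{0\le j\le M}$ is a positive martingale and $\tilde C_j(K)=\mathbb E[(Z_j-K)^+]$ for all $0\le j\le M$ and $K\ge0$. -/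

import Mathlib

open MeasureTheory ProbabilityTheory Set Filter
open scoped NNReal

noncomputable section

namespace SmoothCalls

/-- Undiscounted Black--Scholes call price with spot `s > 0`, strike `k ≥ 0` and total variance
`v ≥ 0`. For `v = 0` or `k = 0` the quantities `d₊, d₋` are infinite and the formula is read as its
limit, the intrinsic value `(s - k)⁺`. -/
def bsCall (s k v : ℝ) : ℝ :=
  if v = 0 ∨ k = 0 then max (s - k) 0
  else
    s * cdf (gaussianReal 0 1) ((-Real.log (k / s) + v / 2) / √v)
      - k * cdf (gaussianReal 0 1) ((-Real.log (k / s) - v / 2) / √v)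

/-- `C : [0,∞)² → [0,∞)` (only the values at nonnegative arguments matter) is an arbitrage-free
call price surface: it has a positive martingale representation started at one. -/
def ArbitrageFree (C : ℝ → ℝ → ℝ) : Prop :=
  ∃ (Ω : Type) (_ : MeasurableSpace Ω) (P : Measure Ω) (_ : IsProbabilityMeasure P)
    (ℱ : Filtration ℝ≥0 ‹MeasurableSpace Ω›) (Z : ℝ≥0 → Ω → ℝ),
    Martingale Z ℱ P ∧
    (∀ t, ∀ᵐ ω ∂P, 0 < Z t ω) ∧
    (∀ᵐ ω ∂P, Z 0 ω = 1) ∧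
    ∀ (t : ℝ≥0) (k : ℝ), 0 ≤ k → C t k = ∫ ω, max (Z t ω - k) 0 ∂P

/-- `∂_KK c (k) > 0` for all `k > 0`, where derivatives in strike are right-hand derivatives:
`D` is the right derivative of `c`, and `D` has a positive right derivative everywhere. -/
def SmoothInStrike (c : ℝ → ℝ) : Prop :=
  ∃ D : ℝ → ℝ, (∀ k, 0 < k → HasDerivWithinAt c (D k) (Ioi k) k) ∧
    ∀ k, 0 < k → ∃ g, 0 < g ∧ HasDerivWithinAt D g (Ioi k) k

variable {N : ℕ}

/-- The functions `c̃_j(k; v)` for `j ≥ 1`, given strikes `K i`, densities `q j i` and forward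
variances `dV j i`. (The value at `j = 0` is not used in the recursion.) -/
def cTilde (K : Fin N → ℝ) (q dV : ℕ → Fin N → ℝ) : ℕ → ℝ → ℝ → ℝ
  | 0, k, v => bsCall 1 k v
  | 1, k, v => ∑ i, q 1 i * bsCall (K i) k (dV 1 i + v)
  | j + 2, k, v => ∑ i, q (j + 2) i * K i * cTilde K q dV (j + 1) (k / K i) (dV (j + 2) i + v)

/-- `C̃_j(k) = c̃_j(k; 0)` for `j ≥ 1`, and `C̃_0(k) = (1 - k)⁺`. -/
def CTilde (K : Fin N → ℝ) (q dV : ℕ → Fin N → ℝ) : ℕ → ℝ → ℝ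
  | 0, k => max (1 - k) 0
  | j + 1, k => cTilde K q dV (j + 1) k 0

/-- The surface `C̃(t, k)`: interpolation in time with `α j` on `[T j, T (j + 1))` for `j < M`,
and constant in time from the last expiry `T M` on. -/
def surface (M : ℕ) (T : ℕ → ℝ) (α : ℕ → ℝ → ℝ) (K : Fin N → ℝ) (q dV : ℕ → Fin N → ℝ)
    (t k : ℝ) : ℝ :=
  (∑ j ∈ Finset.range M,
      if T j ≤ t ∧ t < T (j + 1) then
        α j t * CTilde K q dV (j + 1) k + (1 - α j t) * CTilde K q dV j k
      else 0)
    + if T M ≤ t then CTilde K q dV M k else 0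

/-- The driving random variables: `J ℓ` is the (random) index of the strike taken by the jump
`X_ℓ = K (J ℓ)`, so that `X_ℓ ∼ q_ℓ`; the `W ℓ i` are i.i.d. standard normal; all `J ℓ` and all
`W ℓ i` with `1 ≤ ℓ ≤ M` are independent. -/
structure IsDriver (M : ℕ) (q : ℕ → Fin N → ℝ) {Ω : Type*} [MeasurableSpace Ω] (P : Measure Ω)
    (J : ℕ → Ω → Fin N) (W : ℕ → Fin N → Ω → ℝ) : Prop where
  measurable_J : ∀ ℓ ∈ Finset.Icc 1 M, Measurable (J ℓ)
  law_J : ∀ ℓ ∈ Finset.Icc 1 M, ∀ i, P.real {ω | J ℓ ω = i} = q ℓ i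
  measurable_W : ∀ ℓ ∈ Finset.Icc 1 M, ∀ i, Measurable (W ℓ i)
  law_W : ∀ ℓ ∈ Finset.Icc 1 M, ∀ i, P.map (W ℓ i) = gaussianReal 0 1
  indep_J : iIndepFun (fun (ℓ : Finset.Icc 1 M) => J ℓ) P
  indep_W : iIndepFun (fun (p : Finset.Icc 1 M × Fin N) => W p.1 p.2) P
  indep_J_W : IndepFun (fun ω (ℓ : Finset.Icc 1 M) => J ℓ ω)
    (fun ω (p : Finset.Icc 1 M × Fin N) => W p.1 p.2 ω) P

/-- The lognormal factor `Y_ℓ^i = exp (√(dV_ℓ^i) W_ℓ^i - dV_ℓ^i / 2)`. -/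
def logNormalFactor {Ω : Type*} (dV : ℕ → Fin N → ℝ) (W : ℕ → Fin N → Ω → ℝ) (ℓ : ℕ) (i : Fin N)
    (ω : Ω) : ℝ :=
  Real.exp (√(dV ℓ i) * W ℓ i ω - dV ℓ i / 2)

/-- `Z_j = ∏_{ℓ = 1}^j X_ℓ Y_ℓ^{X_ℓ}`, with `X_ℓ = K (J ℓ)` and `Y_ℓ^{X_ℓ}` the factor `Y_ℓ^i` whose
index `i = J ℓ` is that of the strike taken by `X_ℓ`. -/
def productProcess {Ω : Type*} (K : Fin N → ℝ) (dV : ℕ → Fin N → ℝ) (J : ℕ → Ω → Fin N)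
    (W : ℕ → Fin N → Ω → ℝ) (j : ℕ) (ω : Ω) : ℝ :=
  ∏ ℓ ∈ Finset.Icc 1 j, K (J ℓ ω) * logNormalFactor dV W ℓ (J ℓ ω) ω

end SmoothCalls

end

noncomputable section

namespace SmoothCalls

variable {N : ℕ}

/-! The Black–Scholes call is the price of a call on a lognormal variable
(`integral_call_eq_bsCall`), and lognormal laws form a semigroup under multiplicative convolution,
with variances adding (`lognormal_mconv_lognormal`). Hence `cTilde` at `(j, k, v)` is the price of a
call on `Z_j` times an independent lognormal of variance `v`: conditioning on the last jump takes
out its strike by homogeneity and merges its lognormal factor with the extra one, which is the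
recursion (`lintegral_call_productLaw_mconv`). At `v = 0` this prices the slices. The product
process is a martingale because each new factor has mean one and is independent of the past.

For absence of arbitrage, interpolation in time is a mixture of laws, realised by a random clock. A
uniform level `u`, independent of the product process and known from the start, lets step `j + 1` be
made once `α_j` exceeds `u`. Given `u` the clock is deterministic and non-decreasing, so the
time-changed process remains a martingale (`martingale_timeChange`).

For smoothness, every slice is a combination, with nonnegative weights, of rescaled Black–Scholes
prices. Each is convex, with positive second derivative as soon as its variance is positive. Later
steps only add variance to that of step 1, so one nondegenerate term in step 1 suffices. -/

/-! ### The normal distribution and the Black–Scholes formula -/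

lemma continuous_gaussianPDFReal (m : ℝ) (v : ℝ≥0) : Continuous (gaussianPDFReal m v) := by
  unfold gaussianPDFReal
  fun_prop

lemma contDiff_gaussianPDFReal (m : ℝ) (v : ℝ≥0) {n : WithTop ℕ∞} :
    ContDiff ℝ n (gaussianPDFReal m v) := by
  unfold gaussianPDFReal
  fun_prop

lemma hasDerivAt_cdf_gaussianReal (x : ℝ) :
    HasDerivAt (cdf (gaussianReal 0 1)) (gaussianPDFReal 0 1 x) x := by
  have hint : ∀ y, IntegrableOn (gaussianPDFReal 0 1) (Iic y) :=
    fun y => (integrable_gaussianPDFReal 0 1).integrableOn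
  have h : ∀ y, cdf (gaussianReal 0 1) y
      = (∫ t in Iic (0 : ℝ), gaussianPDFReal 0 1 t) + ∫ t in (0 : ℝ)..y, gaussianPDFReal 0 1 t := by
    intro y
    rw [← intervalIntegral.integral_Iic_sub_Iic (hint 0) (hint y), cdf_eq_real, Measure.real,
      gaussianReal_apply_eq_integral 0 one_ne_zero, ENNReal.toReal_ofReal]
    · ring
    · exact integral_nonneg fun t => gaussianPDFReal_nonneg 0 1 t
  have hd := (intervalIntegral.integral_hasDerivAt_right
    ((continuous_gaussianPDFReal 0 1).intervalIntegrable 0 x)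
    ((continuous_gaussianPDFReal 0 1).stronglyMeasurableAtFilter _ _)
    (continuous_gaussianPDFReal 0 1).continuousAt)
  exact (hd.const_add _).congr_of_eventuallyEq (Eventually.of_forall h)

lemma contDiff_cdf_gaussianReal : ContDiff ℝ (⊤ : ℕ∞) (cdf (gaussianReal 0 1)) := by
  rw [contDiff_infty_iff_deriv]
  refine ⟨fun x => (hasDerivAt_cdf_gaussianReal x).differentiableAt, ?_⟩
  rw [show deriv (cdf (gaussianReal 0 1)) = gaussianPDFReal 0 1 from
    funext fun x => (hasDerivAt_cdf_gaussianReal x).deriv]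
  exact contDiff_gaussianPDFReal 0 1

lemma gaussianReal_real_Ici (a : ℝ) :
    (gaussianReal 0 1).real (Ici a) = cdf (gaussianReal 0 1) (-a) := by
  rw [cdf_eq_real]
  conv_lhs => rw [← neg_zero, ← gaussianReal_map_neg]
  rw [map_measureReal_apply measurable_neg measurableSet_Ici]
  congr 1
  ext x
  simp

/-- Completing the square: the exponential density moves the mean of the Gaussian from `0` to `c`.
-/
lemma setIntegral_exp_gaussianReal (c : ℝ) {s : Set ℝ} (hs : MeasurableSet s) :
    ∫ z in s, Real.exp (c * z - c ^ 2 / 2) ∂gaussianReal 0 1 = (gaussianReal c 1).real s := by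
  rw [← integral_indicator hs, integral_gaussianReal_eq_integral_smul one_ne_zero, Measure.real,
    gaussianReal_apply_eq_integral c one_ne_zero, ENNReal.toReal_ofReal
      (integral_nonneg fun t => gaussianPDFReal_nonneg c 1 t), ← integral_indicator hs]
  congr 1
  ext x
  by_cases hx : x ∈ s
  · simp only [hx, indicator_of_mem, smul_eq_mul, gaussianPDFReal]
    rw [mul_assoc, ← Real.exp_add]
    congr 2
    simp
    ring
  · simp [hx]

lemma gaussianReal_one_real_Ici (c a : ℝ) :
    (gaussianReal c 1).real (Ici a) = cdf (gaussianReal 0 1) (c - a) := by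
  rw [← neg_sub, ← gaussianReal_real_Ici]
  conv_lhs => rw [← zero_add c, ← gaussianReal_map_add_const]
  rw [map_measureReal_apply (measurable_add_const c) measurableSet_Ici]
  congr 1
  ext x
  simp

lemma integrable_exp_sub_gaussianReal (c d : ℝ) (m : ℝ) (v : ℝ≥0) :
    Integrable (fun z => Real.exp (c * z - d)) (gaussianReal m v) := by
  simp_rw [Real.exp_sub]
  exact (integrable_exp_mul_gaussianReal c).div_const _

lemma integral_exp_gaussianReal (c : ℝ) :
    ∫ z, Real.exp (c * z - c ^ 2 / 2) ∂gaussianReal 0 1 = 1 := by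
  rw [← setIntegral_univ, setIntegral_exp_gaussianReal c MeasurableSet.univ]
  simp

/-- The Black--Scholes formula. -/
lemma integral_call_eq_bsCall {s k v : ℝ} (hs : 0 < s) (hk : 0 ≤ k) (hv : 0 ≤ v) :
    ∫ z, max (s * Real.exp (√v * z - v / 2) - k) 0 ∂gaussianReal 0 1 = bsCall s k v := by
  have hmean := integral_exp_gaussianReal √v
  rw [Real.sq_sqrt hv] at hmean
  rw [bsCall]
  split_ifs with h
  · rcases h with rfl | rfl
    · simp
    · simp only [sub_zero]
      have hpos : ∀ z, max (s * Real.exp (√v * z - v / 2)) 0 = s * Real.exp (√v * z - v / 2) :=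
        fun z => max_eq_left (by positivity)
      simp_rw [hpos]
      rw [max_eq_left hs.le, integral_const_mul, hmean, mul_one]
  push Not at h
  obtain ⟨hv', hk'⟩ := h
  replace hv' : 0 < v := lt_of_le_of_ne hv (Ne.symm hv')
  replace hk' : 0 < k := lt_of_le_of_ne hk (Ne.symm hk')
  have hsv : 0 < √v := Real.sqrt_pos.2 hv'
  -- The exercise threshold: the payoff is nonnegative exactly for `z ≥ a`. Here `-a` is `d₋` and
  -- `√v - a` is `d₊`.
  set a : ℝ := (Real.log (k / s) + v / 2) / √v with ha
  have hiff : ∀ z, a ≤ z ↔ k ≤ s * Real.exp (√v * z - v / 2) := by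
    intro z
    rw [ha, div_le_iff₀ hsv, ← div_le_iff₀' hs, ← Real.log_le_iff_le_exp (by positivity),
      mul_comm √v]
    constructor <;> intro h <;> linarith
  have hmax : ∀ z, max (s * Real.exp (√v * z - v / 2) - k) 0
      = (Ici a).indicator (fun z => s * Real.exp (√v * z - v / 2) - k) z := by
    intro z
    by_cases hz : a ≤ z
    · rw [indicator_of_mem (mem_Ici.2 hz), max_eq_left (sub_nonneg.2 ((hiff z).1 hz))]
    · rw [indicator_of_notMem (by simpa using hz), max_eq_right]
      have := mt (hiff z).2 hz
      linarith
  simp_rw [hmax]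
  have hint := integrable_exp_sub_gaussianReal √v (v / 2) 0 1
  rw [integral_indicator measurableSet_Ici,
    integral_sub (hint.const_mul s).integrableOn (integrable_const k).integrableOn,
    integral_const_mul, setIntegral_const, gaussianReal_real_Ici]
  -- The spot term is the mass of `[a, ∞)` after the mean has moved to `√v`.
  have htilt := setIntegral_exp_gaussianReal √v (measurableSet_Ici (a := a))
  rw [Real.sq_sqrt hv, gaussianReal_one_real_Ici] at htilt
  rw [htilt, smul_eq_mul, mul_comm k]
  have hsq : √v * √v = v := Real.mul_self_sqrt hv
  congr 3
  · rw [ha]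
    field_simp
    rw [Real.sq_sqrt hv]
    ring
  · rw [ha]
    ring

/-! ### Second right derivatives in strike -/

/-- On `(0, ∞)`, `c` has the right derivative `D`, and `D` has the right derivative `g`. -/
def HasSecondRightDeriv (c D g : ℝ → ℝ) : Prop :=
  ∀ k, 0 < k → HasDerivWithinAt c (D k) (Ioi k) k ∧ HasDerivWithinAt D (g k) (Ioi k) k

/-- `c` is twice right differentiable on `(0, ∞)` with nonnegative second right derivative, as is
the case for all slices considered here. -/
def RightConvex (c : ℝ → ℝ) : Prop :=
  ∃ D g, HasSecondRightDeriv c D g ∧ ∀ k, 0 < k → 0 ≤ g k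

lemma smoothInStrike_iff {c : ℝ → ℝ} :
    SmoothInStrike c ↔ ∃ D g, HasSecondRightDeriv c D g ∧ ∀ k, 0 < k → 0 < g k := by
  constructor
  · rintro ⟨D, hD, hg⟩
    choose! g hg using hg
    exact ⟨D, g, fun k hk => ⟨hD k hk, (hg k hk).2⟩, fun k hk => (hg k hk).1⟩
  · rintro ⟨D, g, h, hg⟩
    exact ⟨D, fun k hk => (h k hk).1, fun k hk => ⟨g k, hg k hk, (h k hk).2⟩⟩

lemma SmoothInStrike.rightConvex {c : ℝ → ℝ} (h : SmoothInStrike c) : RightConvex c := by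
  obtain ⟨D, g, h, hg⟩ := smoothInStrike_iff.1 h
  exact ⟨D, g, h, fun k hk => (hg k hk).le⟩

lemma HasSecondRightDeriv.add {c D g c' D' g' : ℝ → ℝ} (h : HasSecondRightDeriv c D g)
    (h' : HasSecondRightDeriv c' D' g') :
    HasSecondRightDeriv (fun k => c k + c' k) (fun k => D k + D' k) (fun k => g k + g' k) :=
  fun k hk => ⟨(h k hk).1.add (h' k hk).1, (h k hk).2.add (h' k hk).2⟩

lemma HasSecondRightDeriv.const_mul {c D g : ℝ → ℝ} (a : ℝ) (h : HasSecondRightDeriv c D g) :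
    HasSecondRightDeriv (fun k => a * c k) (fun k => a * D k) (fun k => a * g k) :=
  fun k hk => ⟨(h k hk).1.const_mul a, (h k hk).2.const_mul a⟩

lemma hasDerivWithinAt_comp_div {f : ℝ → ℝ} {f' a k : ℝ} (ha : 0 < a)
    (h : HasDerivWithinAt f f' (Ioi (k / a)) (k / a)) :
    HasDerivWithinAt (fun x => f (x / a)) (f' / a) (Ioi k) k := by
  have := h.scomp (h := fun x : ℝ => x / a) k ((hasDerivAt_id k).div_const a).hasDerivWithinAt
    (s := Ioi k) (fun x hx => div_lt_div_of_pos_right hx ha)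
  simpa [Function.comp_def, div_eq_inv_mul] using this

lemma HasSecondRightDeriv.comp_div {c D g : ℝ → ℝ} {a : ℝ} (ha : 0 < a)
    (h : HasSecondRightDeriv c D g) :
    HasSecondRightDeriv (fun k => c (k / a)) (fun k => D (k / a) / a)
      (fun k => g (k / a) / a / a) :=
  fun _ hk => ⟨hasDerivWithinAt_comp_div ha (h _ (div_pos hk ha)).1,
    (hasDerivWithinAt_comp_div ha (h _ (div_pos hk ha)).2).div_const a⟩

lemma RightConvex.add {c c' : ℝ → ℝ} (h : RightConvex c) (h' : RightConvex c') :
    RightConvex (fun k => c k + c' k) := by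
  obtain ⟨D, g, h, hg⟩ := h
  obtain ⟨D', g', h', hg'⟩ := h'
  exact ⟨_, _, h.add h', fun k hk => add_nonneg (hg k hk) (hg' k hk)⟩

lemma RightConvex.const_mul {c : ℝ → ℝ} {a : ℝ} (ha : 0 ≤ a) (h : RightConvex c) :
    RightConvex (fun k => a * c k) := by
  obtain ⟨D, g, h, hg⟩ := h
  exact ⟨_, _, h.const_mul a, fun k hk => mul_nonneg ha (hg k hk)⟩

lemma RightConvex.comp_div {c : ℝ → ℝ} {a : ℝ} (ha : 0 < a) (h : RightConvex c) :
    RightConvex (fun k => c (k / a)) := by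
  obtain ⟨D, g, h, hg⟩ := h
  exact ⟨_, _, h.comp_div ha, fun k hk =>
    div_nonneg (div_nonneg (hg _ (div_pos hk ha)) ha.le) ha.le⟩

lemma SmoothInStrike.add {c c' : ℝ → ℝ} (h : SmoothInStrike c) (h' : RightConvex c') :
    SmoothInStrike (fun k => c k + c' k) := by
  obtain ⟨D, g, h, hg⟩ := smoothInStrike_iff.1 h
  obtain ⟨D', g', h', hg'⟩ := h'
  exact smoothInStrike_iff.2
    ⟨_, _, h.add h', fun k hk => add_pos_of_pos_of_nonneg (hg k hk) (hg' k hk)⟩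

lemma SmoothInStrike.const_mul {c : ℝ → ℝ} {a : ℝ} (ha : 0 < a) (h : SmoothInStrike c) :
    SmoothInStrike (fun k => a * c k) := by
  obtain ⟨D, g, h, hg⟩ := smoothInStrike_iff.1 h
  exact smoothInStrike_iff.2 ⟨_, _, h.const_mul a, fun k hk => mul_pos ha (hg k hk)⟩

lemma SmoothInStrike.comp_div {c : ℝ → ℝ} {a : ℝ} (ha : 0 < a) (h : SmoothInStrike c) :
    SmoothInStrike (fun k => c (k / a)) := by
  obtain ⟨D, g, h, hg⟩ := smoothInStrike_iff.1 h
  exact smoothInStrike_iff.2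
    ⟨_, _, h.comp_div ha, fun k hk => div_pos (div_pos (hg _ (div_pos hk ha)) ha) ha⟩

lemma rightConvex_zero : RightConvex fun _ => 0 :=
  ⟨fun _ => 0, fun _ => 0, fun _ _ => ⟨hasDerivWithinAt_const _ _ _,
    hasDerivWithinAt_const _ _ _⟩, fun _ _ => le_rfl⟩

lemma RightConvex.sum {ι : Type*} (s : Finset ι) {c : ι → ℝ → ℝ}
    (h : ∀ i ∈ s, RightConvex (c i)) : RightConvex (fun k => ∑ i ∈ s, c i k) := by
  classical
  induction s using Finset.induction_on with
  | empty => simpa using rightConvex_zero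
  | insert a s ha ih =>
    simp only [Finset.sum_insert ha]
    exact (h a (by simp)).add (ih fun i hi => h i (by simp [hi]))

lemma SmoothInStrike.sum {ι : Type*} {s : Finset ι} {c : ι → ℝ → ℝ}
    (h : ∀ i ∈ s, RightConvex (c i)) {i : ι} (hi : i ∈ s) (h' : SmoothInStrike (c i)) :
    SmoothInStrike (fun k => ∑ i ∈ s, c i k) := by
  classical
  simp only [← Finset.add_sum_erase s _ hi]
  exact h'.add (RightConvex.sum _ fun j hj => h j (Finset.mem_of_mem_erase hj))

/-- The right derivative jumps from `-1` to `0` at `s` and takes the value `0` there, so it is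
locally constant to the right of every point. This is why right-hand derivatives tolerate degenerate
terms with zero variance. -/
lemma rightConvex_intrinsic (s : ℝ) : RightConvex fun k => max (s - k) 0 := by
  refine ⟨fun k => if k < s then -1 else 0, fun _ => 0, fun k _ => ?_, fun _ _ => le_rfl⟩
  dsimp only
  split_ifs with h
  · have hlt : ∀ᶠ x in nhds k, x < s := Iio_mem_nhds h
    constructor
    · refine HasDerivAt.hasDerivWithinAt ?_
      refine ((hasDerivAt_id k).const_sub s).congr_of_eventuallyEq ?_
      filter_upwards [hlt] with x hx
      exact max_eq_left (by simpa using hx.le)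
    · refine HasDerivAt.hasDerivWithinAt ?_
      refine (hasDerivAt_const k (-1 : ℝ)).congr_of_eventuallyEq ?_
      filter_upwards [hlt] with x hx
      simp [hx]
  · push Not at h
    constructor
    · refine (hasDerivWithinAt_const k _ (0 : ℝ)).congr (fun x hx => ?_) ?_
      · exact max_eq_right (by simp only [mem_Ioi] at hx; linarith)
      · exact max_eq_right (by linarith)
    · refine (hasDerivWithinAt_const k _ (0 : ℝ)).congr (fun x hx => ?_) ?_
      · simp only [mem_Ioi] at hx
        simp [(h.trans hx.le)]
      · simp [h]

lemma bsCall_of_pos {s k v : ℝ} (hk : 0 < k) (hv : 0 < v) :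
    bsCall s k v = s * cdf (gaussianReal 0 1) ((-Real.log (k / s) + v / 2) / √v)
      - k * cdf (gaussianReal 0 1) ((-Real.log (k / s) - v / 2) / √v) := by
  rw [bsCall, if_neg (by simp [hk.ne', hv.ne'])]

lemma contDiffOn_bsCall {s v : ℝ} (hs : 0 < s) (hv : 0 < v) :
    ContDiffOn ℝ (⊤ : ℕ∞) (fun k => bsCall s k v) (Ioi 0) := by
  have hlog : ContDiffOn ℝ (⊤ : ℕ∞) (fun k : ℝ => Real.log (k / s)) (Ioi 0) :=
    (contDiffOn_id.div_const s).log fun k hk => (div_pos hk hs).ne'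
  refine ContDiffOn.congr ?_ fun k hk => bsCall_of_pos hk hv
  refine (contDiffOn_const.mul (contDiff_cdf_gaussianReal.comp_contDiffOn ?_)).sub
    (contDiffOn_id.mul (contDiff_cdf_gaussianReal.comp_contDiffOn ?_))
  · exact (hlog.neg.add contDiffOn_const).div_const _
  · exact (hlog.neg.sub contDiffOn_const).div_const _

/-- Since `d₊² - d₋² = -2 log (k / s)`. The identity cancels the density terms in the first strike
derivative of the price. -/
lemma gaussianPDFReal_spot_eq_strike {s k v : ℝ} (hs : 0 < s) (hk : 0 < k) (hv : 0 < v) :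
    s * gaussianPDFReal 0 1 ((-Real.log (k / s) + v / 2) / √v)
      = k * gaussianPDFReal 0 1 ((-Real.log (k / s) - v / 2) / √v) := by
  have h : s = k * Real.exp (-Real.log (k / s)) := by
    rw [Real.exp_neg, Real.exp_log (by positivity)]
    field_simp
  set l := Real.log (k / s)
  simp only [gaussianPDFReal]
  rw [h, mul_assoc, mul_left_comm (Real.exp _), ← Real.exp_add]
  congr 3
  simp only [sub_zero, NNReal.coe_one, mul_one, div_pow, Real.sq_sqrt hv.le]
  field_simp
  ring

/-- The first derivative is `-𝒩(d₋)`; the second is the normal density at `d₋` divided by `k √v`. -/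
lemma smoothInStrike_bsCall {s v : ℝ} (hs : 0 < s) (hv : 0 < v) :
    SmoothInStrike (fun k => bsCall s k v) := by
  have hsv : 0 < √v := Real.sqrt_pos.2 hv
  have hlog : ∀ k, 0 < k → HasDerivAt (fun k : ℝ => Real.log (k / s)) k⁻¹ k := by
    intro k hk
    have := ((hasDerivAt_id k).div_const s).log (div_pos hk hs).ne'
    simp only [id] at this
    convert this using 1
    field_simp
  have hp : ∀ k, 0 < k → HasDerivAt
      (fun k => cdf (gaussianReal 0 1) ((-Real.log (k / s) + v / 2) / √v))
      (gaussianPDFReal 0 1 ((-Real.log (k / s) + v / 2) / √v) * (-k⁻¹ / √v)) k := fun k hk =>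
    (hasDerivAt_cdf_gaussianReal _).comp k (((hlog k hk).neg.add_const (v / 2)).div_const √v)
  have hm : ∀ k, 0 < k → HasDerivAt
      (fun k => cdf (gaussianReal 0 1) ((-Real.log (k / s) - v / 2) / √v))
      (gaussianPDFReal 0 1 ((-Real.log (k / s) - v / 2) / √v) * (-k⁻¹ / √v)) k := fun k hk =>
    (hasDerivAt_cdf_gaussianReal _).comp k (((hlog k hk).neg.sub_const (v / 2)).div_const √v)
  refine ⟨fun k => -cdf (gaussianReal 0 1) ((-Real.log (k / s) - v / 2) / √v), fun k hk => ?_,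
    fun k hk => ⟨_, ?_, (hm k hk).neg.hasDerivWithinAt⟩⟩
  · refine HasDerivAt.hasDerivWithinAt ?_
    have hd := ((hp k hk).const_mul s).sub ((hasDerivAt_id k).mul (hm k hk))
    refine (hd.congr_deriv ?_).congr_of_eventuallyEq ?_
    · rw [← mul_assoc, gaussianPDFReal_spot_eq_strike hs hk hv]
      simp only [id]
      ring
    · filter_upwards [Ioi_mem_nhds hk] with x hx
      exact bsCall_of_pos hx hv
  · have := gaussianPDFReal_pos 0 1 ((-Real.log (k / s) - v / 2) / √v) one_ne_zero
    rw [← mul_neg, neg_div, neg_neg]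
    positivity

lemma rightConvex_bsCall {s v : ℝ} (hs : 0 < s) (hv : 0 ≤ v) :
    RightConvex (fun k => bsCall s k v) := by
  rcases hv.eq_or_lt with rfl | hv
  · simpa [bsCall] using rightConvex_intrinsic s
  · exact (smoothInStrike_bsCall hs hv).rightConvex

/-! ### Convexity and smoothness of the slices -/

section Slices

variable {K : Fin N → ℝ} {q dV : ℕ → Fin N → ℝ} {M : ℕ}

lemma exists_weight_pos {w : Fin N → ℝ} (h : ∑ i, w i = 1) : ∃ i, 0 < w i := by
  by_contra! hw
  have := Finset.sum_nonpos fun i (_ : i ∈ Finset.univ) => hw i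
  linarith

lemma rightConvex_cTilde (hK0 : ∀ i, 0 < K i) (hdV : ∀ j ∈ Finset.Icc 1 M, ∀ i, 0 ≤ dV j i)
    (hq : ∀ j ∈ Finset.Icc 1 M, ∀ i, 0 ≤ q j i) {j : ℕ} (hj : j + 1 ≤ M) :
    ∀ v, 0 ≤ v → RightConvex fun k => cTilde K q dV (j + 1) k v := by
  induction j with
  | zero =>
    intro v hv
    have h1 : 1 ∈ Finset.Icc 1 M := by simp; omega
    exact RightConvex.sum _ fun i _ =>
      (rightConvex_bsCall (hK0 i) (add_nonneg (hdV 1 h1 i) hv)).const_mul (hq 1 h1 i)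
  | succ j ih =>
    intro v hv
    have h1 : j + 2 ∈ Finset.Icc 1 M := by simp; omega
    exact RightConvex.sum _ fun i _ =>
      ((ih (by omega) _ (add_nonneg (hdV _ h1 i) hv)).comp_div (hK0 i)).const_mul
        (mul_nonneg (hq _ h1 i) (hK0 i).le)

/-- In step 1 a single nondegenerate term suffices, the others being convex. In later steps every
term inherits strict positivity, and some weight is positive because the weights sum to one. The
induction needs all `v`, since the recursion shifts the variance. -/
lemma smoothInStrike_cTilde (hK0 : ∀ i, 0 < K i) (hdV : ∀ j ∈ Finset.Icc 1 M, ∀ i, 0 ≤ dV j i)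
    (hq : ∀ j ∈ Finset.Icc 1 M, ∀ i, 0 ≤ q j i) (hq_sum : ∀ j ∈ Finset.Icc 1 M, ∑ i, q j i = 1)
    (hpos : ∃ i, 0 < q 1 i ∧ 0 < dV 1 i) {j : ℕ} (hj : j + 1 ≤ M) :
    ∀ v, 0 ≤ v → SmoothInStrike fun k => cTilde K q dV (j + 1) k v := by
  induction j with
  | zero =>
    intro v hv
    have h1 : 1 ∈ Finset.Icc 1 M := by simp; omega
    obtain ⟨i, hqi, hi⟩ := hpos
    exact SmoothInStrike.sum (fun i _ => (rightConvex_bsCall (hK0 i)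
        (add_nonneg (hdV 1 h1 i) hv)).const_mul (hq 1 h1 i)) (Finset.mem_univ i)
      ((smoothInStrike_bsCall (hK0 i) (add_pos_of_pos_of_nonneg hi hv)).const_mul hqi)
  | succ j ih =>
    intro v hv
    have h1 : j + 2 ∈ Finset.Icc 1 M := by simp; omega
    obtain ⟨i, hi⟩ := exists_weight_pos (hq_sum _ h1)
    have hs : ∀ i, SmoothInStrike fun k => cTilde K q dV (j + 1) (k / K i) (dV (j + 2) i + v) :=
      fun i => (ih (by omega) _ (add_nonneg (hdV _ h1 i) hv)).comp_div (hK0 i)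
    exact SmoothInStrike.sum (fun i _ => (hs i).rightConvex.const_mul
      (mul_nonneg (hq _ h1 i) (hK0 i).le)) (Finset.mem_univ i)
      ((hs i).const_mul (mul_pos hi (hK0 i)))

lemma contDiffOn_cTilde (hK0 : ∀ i, 0 < K i) (hdV : ∀ j ∈ Finset.Icc 1 M, ∀ i, 0 ≤ dV j i)
    (hq : ∀ j ∈ Finset.Icc 1 M, ∀ i, 0 ≤ q j i)
    (hpos : ∀ i, 0 < q 1 i → 0 < dV 1 i) {j : ℕ} (hj : j + 1 ≤ M) :
    ∀ v, 0 ≤ v → ContDiffOn ℝ (⊤ : ℕ∞) (fun k => cTilde K q dV (j + 1) k v) (Ioi 0) := by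
  induction j with
  | zero =>
    intro v hv
    have h1 : 1 ∈ Finset.Icc 1 M := by simp; omega
    refine ContDiffOn.sum fun i _ => ?_
    -- A zero weight removes the term, which may have a kink.
    rcases (hq 1 h1 i).eq_or_lt with h0 | h0
    · simpa [← h0] using contDiffOn_const
    · exact contDiffOn_const.mul (contDiffOn_bsCall (hK0 i)
        (add_pos_of_pos_of_nonneg (hpos i h0) hv))
  | succ j ih =>
    intro v hv
    have h1 : j + 2 ∈ Finset.Icc 1 M := by simp; omega
    exact ContDiffOn.sum fun i _ => contDiffOn_const.mul
      ((ih (by omega) _ (add_nonneg (hdV _ h1 i) hv)).comp (contDiffOn_id.div_const (K i))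
        fun k hk => div_pos hk (hK0 i))

end Slices

/-! ### The interpolated surface -/

section Surface

variable {K : Fin N → ℝ} {q dV : ℕ → Fin N → ℝ} {M : ℕ} {T : ℕ → ℝ} {α : ℕ → ℝ → ℝ}

lemma expiry_le (hT : ∀ j < M, T j < T (j + 1)) {i j : ℕ} (hij : i ≤ j) (hj : j ≤ M) :
    T i ≤ T j := by
  induction j, hij using Nat.le_induction with
  | base => exact le_rfl
  | succ n hn ih => exact (ih (by omega)).trans (hT n (by omega)).le

lemma exists_period (hT : ∀ j < M, T j < T (j + 1)) {t : ℝ} (h0 : T 0 ≤ t) (ht : t < T M) :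
    ∃ j < M, T j ≤ t ∧ t < T (j + 1) := by
  induction M with
  | zero => exact absurd h0 (not_le.2 ht)
  | succ n ih =>
    rcases lt_or_ge t (T n) with h | h
    · obtain ⟨j, hj, h⟩ := ih (fun j hj => hT j (by omega)) h
      exact ⟨j, by omega, h⟩
    · exact ⟨n, by omega, h, ht⟩

lemma surface_of_mem_period (hT : ∀ j < M, T j < T (j + 1)) {j : ℕ} (hj : j < M) {t : ℝ}
    (h1 : T j ≤ t) (h2 : t < T (j + 1)) :
    surface M T α K q dV t
      = fun k => α j t * CTilde K q dV (j + 1) k + (1 - α j t) * CTilde K q dV j k := by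
  ext k
  rw [surface, if_neg (not_le.2 (h2.trans_le (expiry_le hT (by omega) le_rfl))), add_zero,
    Finset.sum_eq_single_of_mem j (Finset.mem_range.2 hj), if_pos ⟨h1, h2⟩]
  intro i hi hij
  have hi := Finset.mem_range.1 hi
  refine if_neg fun h => ?_
  rcases lt_or_gt_of_ne hij with hlt | hlt
  · have := expiry_le hT (i := i + 1) (j := j) (by omega) (by omega)
    linarith [h.2]
  · have := expiry_le hT (i := j + 1) (j := i) (by omega) (by omega)
    linarith [h.1]

lemma surface_of_last_le (hT : ∀ j < M, T j < T (j + 1)) {t : ℝ} (ht : T M ≤ t) :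
    surface M T α K q dV t = CTilde K q dV M := by
  ext k
  rw [surface, if_pos ht, Finset.sum_eq_zero, zero_add]
  intro i hi
  have hi := Finset.mem_range.1 hi
  refine if_neg fun h => ?_
  have := expiry_le hT (i := i + 1) (j := M) (by omega) (by omega)
  linarith [h.2]

lemma weight_mem_Icc (hα : ∀ j < M, MonotoneOn (α j) (Set.Icc (T j) (T (j + 1))))
    (hα0 : ∀ j < M, α j (T j) = 0) (hα1 : ∀ j < M, α j (T (j + 1)) = 1) {j : ℕ} (hj : j < M)
    {t : ℝ} (h1 : T j ≤ t) (h2 : t ≤ T (j + 1)) : α j t ∈ Set.Icc (0 : ℝ) 1 := by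
  constructor
  · rw [← hα0 j hj]
    exact hα j hj (left_mem_Icc.2 (h1.trans h2)) ⟨h1, h2⟩ h1
  · rw [← hα1 j hj]
    exact hα j hj ⟨h1, h2⟩ (right_mem_Icc.2 (h1.trans h2)) h2

lemma rightConvex_CTilde (hK0 : ∀ i, 0 < K i) (hdV : ∀ j ∈ Finset.Icc 1 M, ∀ i, 0 ≤ dV j i)
    (hq : ∀ j ∈ Finset.Icc 1 M, ∀ i, 0 ≤ q j i) {j : ℕ} (hj : j ≤ M) :
    RightConvex (CTilde K q dV j) := by
  cases j with
  | zero => exact rightConvex_intrinsic 1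
  | succ j => exact rightConvex_cTilde hK0 hdV hq hj 0 le_rfl

lemma smoothInStrike_surface (hM : 1 ≤ M) (hK0 : ∀ i, 0 < K i) (hT0 : T 0 = 0)
    (hT : ∀ j < M, T j < T (j + 1))
    (hα : ∀ j < M, MonotoneOn (α j) (Set.Icc (T j) (T (j + 1))))
    (hα0 : ∀ j < M, α j (T j) = 0) (hα1 : ∀ j < M, α j (T (j + 1)) = 1)
    (hdV : ∀ j ∈ Finset.Icc 1 M, ∀ i, 0 ≤ dV j i)
    (hq : ∀ j ∈ Finset.Icc 1 M, ∀ i, 0 ≤ q j i) (hq_sum : ∀ j ∈ Finset.Icc 1 M, ∑ i, q j i = 1)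
    (hpos : ∃ i, 0 < q 1 i ∧ 0 < dV 1 i) {t : ℝ} (ht : 0 < t) (ht1 : t < T 1 → 0 < α 0 t) :
    SmoothInStrike (surface M T α K q dV t) := by
  have hs : ∀ j, j + 1 ≤ M → SmoothInStrike (CTilde K q dV (j + 1)) := fun j hj =>
    smoothInStrike_cTilde hK0 hdV hq hq_sum hpos hj 0 le_rfl
  rcases lt_or_ge t (T M) with htM | htM
  · obtain ⟨j, hj, h1, h2⟩ := exists_period hT (hT0 ▸ ht.le) htM
    obtain ⟨ha0, ha1⟩ := weight_mem_Icc hα hα0 hα1 hj h1 h2.le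
    rw [surface_of_mem_period hT hj h1 h2]
    -- With zero weight the surface equals slice `j`, which is smooth unless `j = 0`; that case is
    -- excluded by `ht1`.
    rcases ha0.eq_or_lt with ha | ha
    · cases j with
      | zero => exact absurd (ht1 h2) (by simp [← ha])
      | succ j => simpa [← ha] using hs j (by omega)
    · exact ((hs j hj).const_mul ha).add
        ((rightConvex_CTilde hK0 hdV hq hj.le).const_mul (sub_nonneg.2 ha1))
  · rw [surface_of_last_le hT htM]
    obtain ⟨m, rfl⟩ := Nat.exists_eq_add_of_le' hM
    exact hs m le_rfl

lemma contDiffOn_surface (hM : 1 ≤ M) (hK0 : ∀ i, 0 < K i)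
    (hT : ∀ j < M, T j < T (j + 1)) (hdV : ∀ j ∈ Finset.Icc 1 M, ∀ i, 0 ≤ dV j i)
    (hq : ∀ j ∈ Finset.Icc 1 M, ∀ i, 0 ≤ q j i)
    (hpos : ∀ i, 0 < q 1 i → 0 < dV 1 i) {t : ℝ} (ht : T 1 ≤ t) :
    ContDiffOn ℝ (⊤ : ℕ∞) (surface M T α K q dV t) (Set.Ioi 0) := by
  have hs : ∀ j, j + 1 ≤ M → ContDiffOn ℝ (⊤ : ℕ∞) (CTilde K q dV (j + 1)) (Set.Ioi 0) :=
    fun j hj => contDiffOn_cTilde hK0 hdV hq hpos hj 0 le_rfl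
  rcases lt_or_ge t (T M) with htM | htM
  · obtain ⟨j, hj, h1, h2⟩ := exists_period hT ((expiry_le hT (Nat.zero_le 1) hM).trans ht) htM
    rw [surface_of_mem_period hT hj h1 h2]
    cases j with
    | zero => exact absurd h2 (not_lt.2 ht)
    | succ j =>
      exact (contDiffOn_const.mul (hs _ hj)).add (contDiffOn_const.mul (hs _ hj.le))
  · rw [surface_of_last_le hT htM]
    obtain ⟨m, rfl⟩ := Nat.exists_eq_add_of_le' hM
    exact hs m le_rfl

end Surface

/-! ### Lognormal laws and their multiplicative convolutions -/

/-- The law of `exp (√v W - v / 2)` for a standard normal `W`. -/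
def lognormal (v : ℝ) : Measure ℝ :=
  (gaussianReal 0 1).map fun z => Real.exp (√v * z - v / 2)

instance (v : ℝ) : IsProbabilityMeasure (lognormal v) :=
  Measure.isProbabilityMeasure_map (by fun_prop)

lemma lognormal_zero : lognormal 0 = Measure.dirac 1 := by
  simp [lognormal, Measure.map_const]

lemma lognormal_eq_map_exp {v : ℝ} (hv : 0 ≤ v) :
    lognormal v = (gaussianReal (-(v / 2)) v.toNNReal).map Real.exp := by
  have h : gaussianReal (-(v / 2)) v.toNNReal
      = (gaussianReal 0 1).map (fun z => √v * z - v / 2) := by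
    rw [show (fun z : ℝ => √v * z - v / 2) = (fun z => z - v / 2) ∘ (fun z => √v * z) from rfl,
      ← Measure.map_map (by fun_prop) (by fun_prop), gaussianReal_map_const_mul,
      gaussianReal_map_sub_const]
    congr 1
    · ring
    · ext
      simp [Real.sq_sqrt hv, hv]
  rw [h, Measure.map_map (by fun_prop) (by fun_prop)]
  rfl

/-- The exponential turns the sum of independent Gaussians into a product; the means `-v / 2`, `-w /
2` and the variances add. -/
lemma lognormal_mconv_lognormal {v w : ℝ} (hv : 0 ≤ v) (hw : 0 ≤ w) :
    (lognormal v).mconv (lognormal w) = lognormal (v + w) := by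
  have hexp : Measurable Real.exp := Real.measurable_exp
  rw [lognormal_eq_map_exp hv, lognormal_eq_map_exp hw, lognormal_eq_map_exp (add_nonneg hv hw),
    Real.toNNReal_add hv hw, show -((v + w) / 2) = -(v / 2) + -(w / 2) by ring,
    ← gaussianReal_conv_gaussianReal, Measure.mconv, Measure.map_prod_map _ _ hexp hexp,
    Measure.conv, Measure.map_map (by fun_prop) (by fun_prop),
    Measure.map_map (by fun_prop) (by fun_prop)]
  congr 1
  ext p
  simp [Real.exp_add]

lemma bsCall_nonneg {s k v : ℝ} (hs : 0 < s) (hk : 0 ≤ k) (hv : 0 ≤ v) : 0 ≤ bsCall s k v := by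
  rw [← integral_call_eq_bsCall hs hk hv]
  exact integral_nonneg fun z => le_max_right _ _

lemma bsCall_mul_spot {s a k v : ℝ} (ha : 0 < a) :
    bsCall (a * s) k v = a * bsCall s (k / a) v := by
  simp only [bsCall, div_eq_zero_iff, ha.ne', or_false]
  split_ifs
  · rw [mul_max_of_nonneg _ _ ha.le, mul_zero, mul_sub, mul_div_cancel₀ _ ha.ne']
  · rw [div_div]
    field_simp

/-- `ENNReal.ofReal` truncates at zero and so is itself the call payoff; with lower integrals
Tonelli applies without integrability conditions. -/
lemma lintegral_call_lognormal {k v : ℝ} (hk : 0 ≤ k) (hv : 0 ≤ v) :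
    ∫⁻ y, ENNReal.ofReal (y - k) ∂lognormal v = ENNReal.ofReal (bsCall 1 k v) := by
  rw [← integral_call_eq_bsCall one_pos hk hv, ofReal_integral_eq_lintegral_ofReal,
    lognormal, lintegral_map (by fun_prop) (by fun_prop)]
  · simp [ENNReal.ofReal_max]
  · simp_rw [one_mul]
    exact ((integrable_exp_sub_gaussianReal √v (v / 2) 0 1).sub (integrable_const k)).pos_part
  · exact Eventually.of_forall fun z => le_max_right _ _

lemma lintegral_lognormal {v : ℝ} (hv : 0 ≤ v) :
    ∫⁻ y, ENNReal.ofReal y ∂lognormal v = 1 := by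
  simpa [bsCall] using lintegral_call_lognormal le_rfl hv

/-- The law of the factor `X_ℓ Y_ℓ^{X_ℓ}`: a mixture of scaled lognormal laws. -/
def factorLaw (K w d : Fin N → ℝ) : Measure ℝ :=
  ∑ i, ENNReal.ofReal (w i) • (lognormal (d i)).map (K i * ·)

lemma lintegral_factorLaw (K w d : Fin N → ℝ) {f : ℝ → ENNReal} (hf : Measurable f) :
    ∫⁻ x, f x ∂factorLaw K w d
      = ∑ i, ENNReal.ofReal (w i) * ∫⁻ y, f (K i * y) ∂lognormal (d i) := by
  rw [factorLaw, lintegral_finsetSum_measure]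
  refine Finset.sum_congr rfl fun i _ => ?_
  rw [lintegral_smul_measure, lintegral_map hf (by fun_prop), smul_eq_mul]

instance (K w d : Fin N → ℝ) : IsFiniteMeasure (factorLaw K w d) := by
  refine ⟨?_⟩
  rw [← lintegral_one, lintegral_factorLaw K w d measurable_const]
  simp [ENNReal.sum_lt_top]

lemma lintegral_ofReal_factorLaw {K w d : Fin N → ℝ} (hK : ∀ i, 0 < K i) (hw : ∀ i, 0 ≤ w i)
    (hd : ∀ i, 0 ≤ d i) (hmean : ∑ i, w i * K i = 1) :
    ∫⁻ x, ENNReal.ofReal x ∂factorLaw K w d = 1 := by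
  rw [lintegral_factorLaw K w d (by fun_prop), ← ENNReal.ofReal_one, ← hmean,
    ENNReal.ofReal_sum_of_nonneg fun i _ => mul_nonneg (hw i) (hK i).le]
  refine Finset.sum_congr rfl fun i _ => ?_
  simp_rw [ENNReal.ofReal_mul (hK i).le]
  rw [lintegral_const_mul _ (by fun_prop), lintegral_lognormal (hd i), mul_one,
    ENNReal.ofReal_mul (hw i)]

/-- The law of `Z_j`. -/
def productLaw (K : Fin N → ℝ) (q dV : ℕ → Fin N → ℝ) : ℕ → Measure ℝ
  | 0 => Measure.dirac 1
  | j + 1 => (productLaw K q dV j).mconv (factorLaw K (q (j + 1)) (dV (j + 1)))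

instance (K : Fin N → ℝ) (q dV : ℕ → Fin N → ℝ) (j : ℕ) :
    IsFiniteMeasure (productLaw K q dV j) := by
  induction j with
  | zero => exact inferInstanceAs (IsFiniteMeasure (Measure.dirac 1))
  | succ j ih => exact inferInstanceAs (IsFiniteMeasure ((productLaw K q dV j).mconv _))

/-! ### The recursion as a pricing formula -/

section Prices

variable {K : Fin N → ℝ} {q dV : ℕ → Fin N → ℝ} {M : ℕ}

/-- By homogeneity in the spot, the value chosen at `j = 0` makes the first step an instance of the
general recursion. -/
lemma cTilde_succ (hK0 : ∀ i, 0 < K i) (j : ℕ) (k v : ℝ) :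
    cTilde K q dV (j + 1) k v
      = ∑ i, q (j + 1) i * K i * cTilde K q dV j (k / K i) (dV (j + 1) i + v) := by
  cases j with
  | zero =>
    simp only [cTilde]
    refine Finset.sum_congr rfl fun i _ => ?_
    rw [mul_assoc, ← bsCall_mul_spot (hK0 i), mul_one]
  | succ j => rfl

lemma cTilde_nonneg (hK0 : ∀ i, 0 < K i) (hdV : ∀ j ∈ Finset.Icc 1 M, ∀ i, 0 ≤ dV j i)
    (hq : ∀ j ∈ Finset.Icc 1 M, ∀ i, 0 ≤ q j i) {j : ℕ} (hj : j ≤ M) :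
    ∀ k v, 0 ≤ k → 0 ≤ v → 0 ≤ cTilde K q dV j k v := by
  induction j with
  | zero => exact fun k v hk hv => bsCall_nonneg one_pos hk hv
  | succ j ih =>
    intro k v hk hv
    have h1 : j + 1 ∈ Finset.Icc 1 M := by simp; omega
    rw [cTilde_succ hK0]
    exact Finset.sum_nonneg fun i _ => mul_nonneg (mul_nonneg (hq _ h1 i) (hK0 i).le)
      (ih (by omega) _ _ (div_nonneg hk (hK0 i).le) (add_nonneg (hdV _ h1 i) hv))

/-- The extra lognormal factor is what makes the induction close: it merges with the lognormal part
of the last step, turning `v` into `dV (j + 1) i + v`, while the strike `K i` is taken out of the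
payoff. -/
lemma lintegral_call_productLaw_mconv (hK0 : ∀ i, 0 < K i)
    (hdV : ∀ j ∈ Finset.Icc 1 M, ∀ i, 0 ≤ dV j i)
    (hq : ∀ j ∈ Finset.Icc 1 M, ∀ i, 0 ≤ q j i) {j : ℕ} (hj : j ≤ M) :
    ∀ k v, 0 ≤ k → 0 ≤ v →
      ∫⁻ z, ENNReal.ofReal (z - k) ∂(productLaw K q dV j).mconv (lognormal v)
        = ENNReal.ofReal (cTilde K q dV j k v) := by
  induction j with
  | zero =>
    intro k v hk hv
    rw [productLaw, Measure.dirac_one_mconv]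
    exact lintegral_call_lognormal hk hv
  | succ j ih =>
    intro k v hk hv
    have h1 : j + 1 ∈ Finset.Icc 1 M := by simp; omega
    have hkK : ∀ i, 0 ≤ k / K i := fun i => div_nonneg hk (hK0 i).le
    have hv' : ∀ i, 0 ≤ dV (j + 1) i + v := fun i => add_nonneg (hdV _ h1 i) hv
    rw [cTilde_succ hK0, ENNReal.ofReal_sum_of_nonneg fun i _ =>
      mul_nonneg (mul_nonneg (hq _ h1 i) (hK0 i).le)
        (cTilde_nonneg hK0 hdV hq (by omega) _ _ (hkK i) (hv' i))]
    have hinner : ∀ i, ∫⁻ x, ∫⁻ y, ∫⁻ z, ENNReal.ofReal (x * (K i * y * z) - k) ∂lognormal v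
          ∂lognormal (dV (j + 1) i) ∂productLaw K q dV j
        = ENNReal.ofReal (K i * cTilde K q dV j (k / K i) (dV (j + 1) i + v)) := by
      intro i
      have hscale : ∀ x y z : ℝ, ENNReal.ofReal (x * (K i * y * z) - k)
          = ENNReal.ofReal (K i) * ENNReal.ofReal (x * (y * z) - k / K i) := by
        intro x y z
        rw [← ENNReal.ofReal_mul (hK0 i).le]
        congr 1
        have := (hK0 i).ne'
        field_simp
      rw [ENNReal.ofReal_mul (hK0 i).le, ← ih (by omega) _ _ (hkK i) (hv' i),
        ← lognormal_mconv_lognormal (hdV _ h1 i) hv, Measure.lintegral_mconv (by fun_prop),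
        ← lintegral_const_mul _ (by fun_prop)]
      refine lintegral_congr fun x => ?_
      rw [Measure.lintegral_mconv (by fun_prop), ← lintegral_const_mul _ (by fun_prop)]
      refine lintegral_congr fun y => ?_
      rw [← lintegral_const_mul _ (by fun_prop)]
      exact lintegral_congr fun z => hscale x y z
    -- Associativity attaches the extra lognormal to the last factor instead of to the whole
    -- product.
    rw [productLaw, Measure.mconv_assoc, Measure.lintegral_mconv (by fun_prop)]
    have hfac : ∀ x, ∫⁻ y, ENNReal.ofReal (x * y - k)
          ∂(factorLaw K (q (j + 1)) (dV (j + 1))).mconv (lognormal v)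
        = ∑ i, ENNReal.ofReal (q (j + 1) i) * ∫⁻ y, ∫⁻ z, ENNReal.ofReal (x * (K i * y * z) - k)
            ∂lognormal v ∂lognormal (dV (j + 1) i) := by
      intro x
      rw [Measure.lintegral_mconv (by fun_prop), lintegral_factorLaw]
      exact Measurable.lintegral_prod_right' (f := fun p : ℝ × ℝ =>
        ENNReal.ofReal (x * (p.1 * p.2) - k)) (by fun_prop)
    have hmeas : ∀ i, Measurable fun x => ∫⁻ y, ∫⁻ z, ENNReal.ofReal (x * (K i * y * z) - k)
        ∂lognormal v ∂lognormal (dV (j + 1) i) := by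
      intro i
      refine Measurable.lintegral_prod_right' (f := fun p : ℝ × ℝ =>
        ∫⁻ z, ENNReal.ofReal (p.1 * (K i * p.2 * z) - k) ∂lognormal v) ?_
      exact Measurable.lintegral_prod_right' (f := fun p : (ℝ × ℝ) × ℝ =>
        ENNReal.ofReal (p.1.1 * (K i * p.1.2 * p.2) - k)) (by fun_prop)
    simp_rw [hfac]
    rw [lintegral_finsetSum _ fun i _ => (hmeas i).const_mul _]
    refine Finset.sum_congr rfl fun i _ => ?_
    rw [lintegral_const_mul _ (hmeas i), hinner, mul_assoc, ENNReal.ofReal_mul (hq _ h1 i)]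

lemma CTilde_eq_cTilde (j : ℕ) (k : ℝ) : CTilde K q dV j k = cTilde K q dV j k 0 := by
  cases j with
  | zero => simp [CTilde, cTilde, bsCall]
  | succ j => rfl

lemma lintegral_call_productLaw (hK0 : ∀ i, 0 < K i)
    (hdV : ∀ j ∈ Finset.Icc 1 M, ∀ i, 0 ≤ dV j i)
    (hq : ∀ j ∈ Finset.Icc 1 M, ∀ i, 0 ≤ q j i) {j : ℕ} (hj : j ≤ M) {k : ℝ} (hk : 0 ≤ k) :
    ∫⁻ z, ENNReal.ofReal (z - k) ∂productLaw K q dV j = ENNReal.ofReal (CTilde K q dV j k) := by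
  rw [CTilde_eq_cTilde, ← lintegral_call_productLaw_mconv hK0 hdV hq hj k 0 hk le_rfl,
    lognormal_zero, Measure.mconv_dirac_one]

lemma CTilde_nonneg (hK0 : ∀ i, 0 < K i) (hdV : ∀ j ∈ Finset.Icc 1 M, ∀ i, 0 ≤ dV j i)
    (hq : ∀ j ∈ Finset.Icc 1 M, ∀ i, 0 ≤ q j i) {j : ℕ} (hj : j ≤ M) {k : ℝ} (hk : 0 ≤ k) :
    0 ≤ CTilde K q dV j k :=
  CTilde_eq_cTilde (K := K) (q := q) (dV := dV) j k ▸
    cTilde_nonneg hK0 hdV hq hj k 0 hk le_rfl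

end Prices

/-! ### Independence and the product process -/

/-- Independent σ-algebras, gathered from two independent families. -/
lemma iIndep_sumElim {Ω ι κ : Type*} {m0 : MeasurableSpace Ω} {P : Measure Ω}
    {m₁ : ι → MeasurableSpace Ω} {m₂ : κ → MeasurableSpace Ω} (h₁ : iIndep m₁ P)
    (h₂ : iIndep m₂ P) (h : Indep (⨆ i, m₁ i) (⨆ i, m₂ i) P) :
    iIndep (Sum.elim m₁ m₂) P := by
  rw [iIndep_iff]
  intro s f hf
  have hl : ∀ i ∈ s.toLeft, MeasurableSet[m₁ i] (f (Sum.inl i)) := fun i hi =>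
    hf _ (Finset.mem_toLeft.1 hi)
  have hr : ∀ i ∈ s.toRight, MeasurableSet[m₂ i] (f (Sum.inr i)) := fun i hi =>
    hf _ (Finset.mem_toRight.1 hi)
  have hs : ⋂ i ∈ s, f i
      = (⋂ i ∈ s.toLeft, f (Sum.inl i)) ∩ ⋂ i ∈ s.toRight, f (Sum.inr i) := by
    ext ω
    simp
  rw [hs, (Indep_iff _ _ P).1 h _ _
      (Finset.measurableSet_biInter _ fun i hi => le_iSup m₁ i _ (hl i hi))
      (Finset.measurableSet_biInter _ fun i hi => le_iSup m₂ i _ (hr i hi)),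
    (iIndep_iff m₁ P).1 h₁ _ hl, (iIndep_iff m₂ P).1 h₂ _ hr,
    ← Finset.prod_disjSum s.toLeft s.toRight (fun i => P (f i)), Finset.toLeft_disjSum_toRight]

/-- The factor `X_ℓ Y_ℓ^{X_ℓ}`. -/
def factor {Ω : Type*} (K : Fin N → ℝ) (dV : ℕ → Fin N → ℝ) (J : ℕ → Ω → Fin N)
    (W : ℕ → Fin N → Ω → ℝ) (ℓ : ℕ) (ω : Ω) : ℝ :=
  K (J ℓ ω) * logNormalFactor dV W ℓ (J ℓ ω) ω

section Factor

variable {Ω : Type*} {K : Fin N → ℝ} {q dV : ℕ → Fin N → ℝ} {J : ℕ → Ω → Fin N}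
  {W : ℕ → Fin N → Ω → ℝ} {M : ℕ}

lemma factor_pos (hK0 : ∀ i, 0 < K i) (ℓ : ℕ) (ω : Ω) : 0 < factor K dV J W ℓ ω :=
  mul_pos (hK0 _) (Real.exp_pos _)

lemma productProcess_pos (hK0 : ∀ i, 0 < K i) (j : ℕ) (ω : Ω) :
    0 < productProcess K dV J W j ω :=
  Finset.prod_pos fun ℓ _ => factor_pos hK0 ℓ ω

lemma productProcess_zero (ω : Ω) : productProcess K dV J W 0 ω = 1 := by
  simp [productProcess]

lemma productProcess_succ (j : ℕ) :
    productProcess K dV J W (j + 1) = productProcess K dV J W j * factor K dV J W (j + 1) := by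
  ext ω
  simp only [productProcess, Pi.mul_apply]
  rw [Finset.prod_Icc_succ_top (by omega)]
  rfl

/-- The index is random but takes countably many values, so measurability is checked index by index.
The σ-algebra is left free in order to cover those generated by some of the drivers. -/
lemma measurable_factor {m : MeasurableSpace Ω} {ℓ : ℕ} (hJ : Measurable (J ℓ))
    (hW : ∀ i, Measurable (W ℓ i)) : Measurable (factor K dV J W ℓ) := by
  have : Measurable fun p : Fin N × Ω => K p.1 * logNormalFactor dV W ℓ p.1 p.2 := by
    refine measurable_from_prod_countable_right fun i => ?_
    have := hW i
    simp only [logNormalFactor]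
    fun_prop
  exact this.comp (hJ.prodMk measurable_id)

/-- The σ-algebras generated by the individual driving variables. -/
abbrev driverAlgebra (M : ℕ) (J : ℕ → Ω → Fin N) (W : ℕ → Fin N → Ω → ℝ) :
    Finset.Icc 1 M ⊕ (Finset.Icc 1 M × Fin N) → MeasurableSpace Ω :=
  Sum.elim (fun ℓ => MeasurableSpace.comap (J ℓ) inferInstance)
    (fun p => MeasurableSpace.comap (W p.1 p.2) inferInstance)

/-- The step `ℓ` to which a driving variable belongs. -/
def driverStep (M : ℕ) : Finset.Icc 1 M ⊕ (Finset.Icc 1 M × Fin N) → ℕ :=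
  Sum.elim (fun ℓ => ℓ) (fun p => p.1)

/-- Serves twice: with the steps up to `j` for adaptedness, and with step `j + 1` alone for
independence of the past. -/
lemma measurable_factor_iSup {S : Set (Finset.Icc 1 M ⊕ (Finset.Icc 1 M × Fin N))} {ℓ : ℕ}
    (hℓ : ℓ ∈ Finset.Icc 1 M) (hS : ∀ x, driverStep M x = ℓ → x ∈ S) :
    Measurable[⨆ x ∈ S, driverAlgebra M J W x] (factor K dV J W ℓ) := by
  refine @measurable_factor _ _ _ _ _ _ (⨆ x ∈ S, driverAlgebra M J W x) _ ?_ fun i => ?_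
  · exact (comap_measurable (J ℓ)).mono
      (le_iSup₂_of_le (f := fun x (_ : x ∈ S) => driverAlgebra M J W x)
        (Sum.inl ⟨ℓ, hℓ⟩) (hS _ rfl) le_rfl) le_rfl
  · exact (comap_measurable (W ℓ i)).mono
      (le_iSup₂_of_le (f := fun x (_ : x ∈ S) => driverAlgebra M J W x)
        (Sum.inr (⟨ℓ, hℓ⟩, i)) (hS _ rfl) le_rfl) le_rfl

end Factor

namespace IsDriver

variable {Ω : Type*} [MeasurableSpace Ω] {P : Measure Ω} {K : Fin N → ℝ} {q dV : ℕ → Fin N → ℝ}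
  {J : ℕ → Ω → Fin N} {W : ℕ → Fin N → Ω → ℝ} {M : ℕ}

lemma driverAlgebra_le (h : IsDriver M q P J W)
    (x : Finset.Icc 1 M ⊕ (Finset.Icc 1 M × Fin N)) :
    driverAlgebra M J W x ≤ ‹MeasurableSpace Ω› := by
  rcases x with ℓ | p
  · exact (h.measurable_J ℓ ℓ.2).comap_le
  · exact (h.measurable_W p.1 p.1.2 p.2).comap_le

/-- One jointly independent family is needed, since then disjoint blocks of drivers generate
independent σ-algebras. -/
lemma iIndep_driverAlgebra (h : IsDriver M q P J W) : iIndep (driverAlgebra M J W) P := by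
  refine iIndep_sumElim h.indep_J.iIndep h.indep_W.iIndep ?_
  have := (IndepFun_iff_Indep _ _ P).1 h.indep_J_W
  simp only [MeasurableSpace.pi, MeasurableSpace.comap_iSup, MeasurableSpace.comap_comp] at this
  exact this

/-- The filtration generated by the driving variables of the first `j` steps. -/
def filtration (h : IsDriver M q P J W) : Filtration ℕ ‹MeasurableSpace Ω› where
  seq j := ⨆ x ∈ {x | driverStep M x ≤ j}, driverAlgebra M J W x
  mono' _ _ hij := biSup_mono fun _ hx => le_trans hx hij
  le' _ := iSup₂_le fun x _ => h.driverAlgebra_le x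

lemma measurable_factor (h : IsDriver M q P J W) {ℓ : ℕ} (hℓ : ℓ ∈ Finset.Icc 1 M) :
    Measurable (factor K dV J W ℓ) :=
  SmoothCalls.measurable_factor (h.measurable_J ℓ hℓ) (h.measurable_W ℓ hℓ)

lemma measurable_filtration_product (h : IsDriver M q P J W) {j : ℕ} (hj : j ≤ M) :
    Measurable[h.filtration j] (productProcess K dV J W j) := by
  refine @Finset.measurable_fun_prod _ _ _ _ _ _ (h.filtration j) _ _ fun ℓ hℓ => ?_
  rw [Finset.mem_Icc] at hℓ
  exact measurable_factor_iSup (K := K) (dV := dV) (Finset.mem_Icc.2 ⟨hℓ.1, hℓ.2.trans hj⟩)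
    fun x hx => hx.trans_le hℓ.2

lemma measurable_product (h : IsDriver M q P J W) {j : ℕ} (hj : j ≤ M) :
    Measurable (productProcess K dV J W j) :=
  (h.measurable_filtration_product hj).mono (h.filtration.le j) le_rfl

lemma indep_comap_factor (h : IsDriver M q P J W) {j : ℕ} (hj : j + 1 ≤ M) :
    Indep (MeasurableSpace.comap (factor K dV J W (j + 1)) inferInstance) (h.filtration j) P := by
  have hdisj : Disjoint {x | driverStep (N := N) M x = j + 1} {x | driverStep M x ≤ j} := by
    rw [Set.disjoint_left]
    intro x hx hx'
    simp only [mem_ofPred_eq] at hx hx'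
    omega
  refine indep_of_indep_of_le_left
    (indep_iSup_of_disjoint h.driverAlgebra_le h.iIndep_driverAlgebra hdisj) ?_
  exact (measurable_factor_iSup (K := K) (dV := dV) (Finset.mem_Icc.2 ⟨by omega, hj⟩)
    fun x hx => hx).comap_le

lemma law_J_eq [IsProbabilityMeasure P] (h : IsDriver M q P J W) {ℓ : ℕ}
    (hℓ : ℓ ∈ Finset.Icc 1 M) (i : Fin N) : P (J ℓ ⁻¹' {i}) = ENNReal.ofReal (q ℓ i) := by
  rw [← h.law_J ℓ hℓ i, ofReal_measureReal]
  rfl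

lemma map_factor [IsProbabilityMeasure P] (h : IsDriver M q P J W) {ℓ : ℕ}
    (hℓ : ℓ ∈ Finset.Icc 1 M) :
    P.map (factor K dV J W ℓ) = factorLaw K (q ℓ) (dV ℓ) := by
  ext s hs
  have hJ := h.measurable_J ℓ hℓ
  let g : Fin N → ℝ → ℝ := fun i z => K i * Real.exp (√(dV ℓ i) * z - dV ℓ i / 2)
  have hg : ∀ i, Measurable (g i) := fun i => by fun_prop
  have hind : ∀ i, IndepFun (J ℓ) (W ℓ i) P := fun i =>
    h.indep_J_W.comp (φ := fun f : Finset.Icc 1 M → Fin N => f ⟨ℓ, hℓ⟩)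
      (ψ := fun f : Finset.Icc 1 M × Fin N → ℝ => f (⟨ℓ, hℓ⟩, i))
      (measurable_pi_apply _) (measurable_pi_apply _)
  -- On `J ℓ = i` the factor is a function of `W ℓ i` alone, which is independent of `J ℓ`.
  have hunion : factor K dV J W ℓ ⁻¹' s = ⋃ i, J ℓ ⁻¹' {i} ∩ W ℓ i ⁻¹' (g i ⁻¹' s) := by
    ext ω
    simp only [mem_iUnion, mem_inter_iff, mem_preimage, mem_singleton_iff, exists_eq_left']
    rfl
  rw [Measure.map_apply (h.measurable_factor hℓ) hs, hunion, measure_iUnion]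
  · rw [tsum_fintype, factorLaw, Measure.finsetSum_apply]
    refine Finset.sum_congr rfl fun i _ => ?_
    rw [(hind i).measure_inter_preimage_eq_mul _ _ (measurableSet_singleton i) (hg i hs),
      h.law_J_eq hℓ, ← Measure.map_apply (h.measurable_W ℓ hℓ i) (hg i hs), h.law_W ℓ hℓ i,
      Measure.smul_apply, smul_eq_mul, lognormal, Measure.map_map (by fun_prop) (by fun_prop),
      Measure.map_apply (by fun_prop) hs]
    rfl
  · intro i j hij
    refine Set.disjoint_left.2 fun ω hi hj => hij ?_
    exact hi.1.symm.trans hj.1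
  · exact fun i => (hJ (measurableSet_singleton i)).inter
      (h.measurable_W ℓ hℓ i (hg i hs))

lemma map_product [IsProbabilityMeasure P] (h : IsDriver M q P J W) {j : ℕ}
    (hj : j ≤ M) : P.map (productProcess K dV J W j) = productLaw K q dV j := by
  induction j with
  | zero =>
    have : productProcess K dV J W 0 = fun _ => 1 := funext productProcess_zero
    rw [this, Measure.map_const]
    simp [productLaw]
  | succ j ih =>
    have hj' : j + 1 ∈ Finset.Icc 1 M := Finset.mem_Icc.2 ⟨by omega, hj⟩
    have hind : IndepFun (productProcess K dV J W j) (factor K dV J W (j + 1)) P := by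
      rw [IndepFun_iff_Indep]
      exact indep_of_indep_of_le_left (h.indep_comap_factor hj).symm
        (h.measurable_filtration_product (by omega)).comap_le
    rw [productProcess_succ, hind.map_mul_eq_map_mconv_map
      (h.measurable_product (by omega)) (h.measurable_factor hj'), ih (by omega),
      h.map_factor hj']
    rfl

lemma lintegral_call [IsProbabilityMeasure P] (h : IsDriver M q P J W) (hK0 : ∀ i, 0 < K i)
    (hdV : ∀ j ∈ Finset.Icc 1 M, ∀ i, 0 ≤ dV j i)
    (hq : ∀ j ∈ Finset.Icc 1 M, ∀ i, 0 ≤ q j i) {j : ℕ} (hj : j ≤ M) {k : ℝ} (hk : 0 ≤ k) :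
    ∫⁻ ω, ENNReal.ofReal (productProcess K dV J W j ω - k) ∂P
      = ENNReal.ofReal (CTilde K q dV j k) := by
  rw [← lintegral_call_productLaw hK0 hdV hq hj hk, ← h.map_product hj,
    lintegral_map (by fun_prop) (h.measurable_product hj)]

lemma integrable_product [IsProbabilityMeasure P] (h : IsDriver M q P J W)
    (hK0 : ∀ i, 0 < K i) (hdV : ∀ j ∈ Finset.Icc 1 M, ∀ i, 0 ≤ dV j i)
    (hq : ∀ j ∈ Finset.Icc 1 M, ∀ i, 0 ≤ q j i) {j : ℕ} (hj : j ≤ M) :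
    Integrable (productProcess K dV J W j) P := by
  refine ⟨(h.measurable_product hj).aestronglyMeasurable, ?_⟩
  rw [hasFiniteIntegral_iff_ofReal
    (Eventually.of_forall fun ω => (productProcess_pos hK0 j ω).le)]
  have := h.lintegral_call hK0 hdV hq hj le_rfl
  simp only [sub_zero] at this
  rw [this]
  exact ENNReal.ofReal_lt_top

lemma integral_call [IsProbabilityMeasure P] (h : IsDriver M q P J W) (hK0 : ∀ i, 0 < K i)
    (hdV : ∀ j ∈ Finset.Icc 1 M, ∀ i, 0 ≤ dV j i)
    (hq : ∀ j ∈ Finset.Icc 1 M, ∀ i, 0 ≤ q j i) {j : ℕ} (hj : j ≤ M) {k : ℝ} (hk : 0 ≤ k) :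
    ∫ ω, max (productProcess K dV J W j ω - k) 0 ∂P = CTilde K q dV j k := by
  have hm := h.measurable_product (K := K) (dV := dV) hj
  rw [integral_eq_lintegral_of_nonneg_ae (f := fun ω => max (productProcess K dV J W j ω - k) 0)
    (Eventually.of_forall fun ω => le_max_right _ _) (by fun_prop)]
  simp only [ENNReal.ofReal_max, ENNReal.ofReal_zero, zero_le, sup_of_le_left]
  rw [h.lintegral_call hK0 hdV hq hj hk,
    ENNReal.toReal_ofReal (CTilde_nonneg hK0 hdV hq hj hk)]

lemma lintegral_factor [IsProbabilityMeasure P] (h : IsDriver M q P J W) (hK0 : ∀ i, 0 < K i)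
    (hdV : ∀ j ∈ Finset.Icc 1 M, ∀ i, 0 ≤ dV j i)
    (hq : ∀ j ∈ Finset.Icc 1 M, ∀ i, 0 ≤ q j i)
    (hq_mean : ∀ j ∈ Finset.Icc 1 M, ∑ i, q j i * K i = 1) {ℓ : ℕ} (hℓ : ℓ ∈ Finset.Icc 1 M) :
    ∫⁻ ω, ENNReal.ofReal (factor K dV J W ℓ ω) ∂P = 1 := by
  rw [← lintegral_ofReal_factorLaw hK0 (hq ℓ hℓ) (hdV ℓ hℓ) (hq_mean ℓ hℓ), ← h.map_factor hℓ,
    lintegral_map (by fun_prop) (h.measurable_factor hℓ)]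

/-- The product process, stopped after the last step, is a martingale. -/
lemma martingale [IsProbabilityMeasure P] (h : IsDriver M q P J W) (hK0 : ∀ i, 0 < K i)
    (hdV : ∀ j ∈ Finset.Icc 1 M, ∀ i, 0 ≤ dV j i)
    (hq : ∀ j ∈ Finset.Icc 1 M, ∀ i, 0 ≤ q j i)
    (hq_mean : ∀ j ∈ Finset.Icc 1 M, ∑ i, q j i * K i = 1) :
    Martingale (fun j => productProcess K dV J W (min j M)) h.filtration P := by
  have hmeas : ∀ j, Measurable[h.filtration j] (productProcess K dV J W (min j M)) := fun j =>
    (h.measurable_filtration_product (min_le_right j M)).mono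
      (h.filtration.mono (min_le_left j M)) le_rfl
  have hint : ∀ j, Integrable (productProcess K dV J W (min j M)) P := fun j =>
    h.integrable_product hK0 hdV hq (min_le_right j M)
  refine martingale_nat (fun j => (hmeas j).stronglyMeasurable) hint fun j => ?_
  rcases le_or_gt M j with hj | hj
  · rw [min_eq_right hj, min_eq_right (by omega : M ≤ j + 1)]
    have := condExp_of_stronglyMeasurable (h.filtration.le j) (hmeas j).stronglyMeasurable (hint j)
    rw [min_eq_right hj] at this
    rw [this]
  · have hj' : j + 1 ∈ Finset.Icc 1 M := Finset.mem_Icc.2 ⟨by omega, hj⟩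
    have hlint := h.lintegral_factor (dV := dV) hK0 hdV hq hq_mean hj'
    have hfm := h.measurable_factor (K := K) (dV := dV) hj'
    have hfint : Integrable (factor K dV J W (j + 1)) P := by
      refine ⟨hfm.aestronglyMeasurable, ?_⟩
      rw [hasFiniteIntegral_iff_ofReal (Eventually.of_forall fun ω => (factor_pos hK0 _ ω).le),
        hlint]
      exact ENNReal.one_lt_top
    have hmean : ∫ ω, factor K dV J W (j + 1) ω ∂P = 1 := by
      rw [integral_eq_lintegral_of_nonneg_ae
        (Eventually.of_forall fun ω => (factor_pos hK0 _ ω).le) hfm.aestronglyMeasurable, hlint,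
        ENNReal.toReal_one]
    have hprod := hint (j + 1)
    have hm := hmeas j
    rw [min_eq_left (by omega : j + 1 ≤ M), productProcess_succ] at *
    rw [min_eq_left hj.le] at *
    -- The known value `Z_j` is pulled out, and the independent factor is replaced by its mean, one.
    have h1 := condExp_mul_of_stronglyMeasurable_left hm.stronglyMeasurable hprod hfint
    have h2 := condExp_indep_eq (m₁ := MeasurableSpace.comap (factor K dV J W (j + 1)) inferInstance)
      hfm.comap_le (h.filtration.le j)
      (comap_measurable (factor K dV J W (j + 1))).stronglyMeasurable (h.indep_comap_factor hj)
    filter_upwards [h1, h2] with ω h1 h2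
    rw [h1, Pi.mul_apply, h2, hmean, mul_one]

/-- The product process is a martingale on `{0, …, M}`. -/
lemma exists_martingale_fin [IsProbabilityMeasure P] (h : IsDriver M q P J W)
    (hK0 : ∀ i, 0 < K i) (hdV : ∀ j ∈ Finset.Icc 1 M, ∀ i, 0 ≤ dV j i)
    (hq : ∀ j ∈ Finset.Icc 1 M, ∀ i, 0 ≤ q j i)
    (hq_mean : ∀ j ∈ Finset.Icc 1 M, ∑ i, q j i * K i = 1) :
    ∃ ℱ : Filtration (Fin (M + 1)) ‹MeasurableSpace Ω›,
      Martingale (fun j : Fin (M + 1) => productProcess K dV J W j) ℱ P := by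
  have hmart := h.martingale hK0 hdV hq hq_mean
  refine ⟨⟨fun j => h.filtration j, fun i j hij => h.filtration.mono hij,
    fun j => h.filtration.le j⟩, fun j => ?_, fun i j hij => ?_⟩
  · have := hmart.1 j
    beta_reduce at this
    rwa [min_eq_left (Nat.le_of_lt_succ j.2)] at this
  · have := hmart.2 i j hij
    beta_reduce at this
    rwa [min_eq_left (Nat.le_of_lt_succ j.2), min_eq_left (Nat.le_of_lt_succ i.2)] at this

end IsDriver

/-! ### Existence of the driving variables -/

lemma exists_isDriver {q : ℕ → Fin N → ℝ} {M : ℕ} (hM : 1 ≤ M)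
    (hq : ∀ j ∈ Finset.Icc 1 M, ∀ i, 0 ≤ q j i)
    (hq_sum : ∀ j ∈ Finset.Icc 1 M, ∑ i, q j i = 1) :
    ∃ (Ω : Type) (_ : MeasurableSpace Ω) (P : Measure Ω) (_ : IsProbabilityMeasure P)
      (J : ℕ → Ω → Fin N) (W : ℕ → Fin N → Ω → ℝ), IsDriver M q P J W := by
  -- A default index for `J ℓ` outside `1, …, M`; it exists because an empty sum of weights could
  -- not be one.
  obtain ⟨i₀, -⟩ := exists_weight_pos (hq_sum 1 (Finset.mem_Icc.2 ⟨le_rfl, hM⟩))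
  let μ : Finset.Icc 1 M → Measure (Fin N) := fun ℓ =>
    ∑ i, ENNReal.ofReal (q ℓ i) • Measure.dirac i
  have hμ : ∀ ℓ : Finset.Icc 1 M, ∀ i, μ ℓ {i} = ENNReal.ofReal (q ℓ i) := by
    intro ℓ i
    simp only [μ, Measure.finsetSum_apply, Measure.smul_apply, smul_eq_mul]
    rw [Finset.sum_eq_single i]
    · simp
    · intro j _ hj
      simp [hj]
    · simp
  have hprob : ∀ ℓ, IsProbabilityMeasure (μ ℓ) := fun ℓ => by
    refine ⟨?_⟩
    simp only [μ, Measure.finsetSum_apply, Measure.smul_apply, smul_eq_mul, measure_univ, mul_one]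
    rw [← ENNReal.ofReal_sum_of_nonneg fun i _ => hq ℓ ℓ.2 i, hq_sum ℓ ℓ.2, ENNReal.ofReal_one]
  let γ : Finset.Icc 1 M × Fin N → Measure ℝ := fun _ => gaussianReal 0 1
  let P₁ := Measure.pi μ
  let P₂ := Measure.pi γ
  let J : ℕ → (Finset.Icc 1 M → Fin N) × (Finset.Icc 1 M × Fin N → ℝ) → Fin N :=
    fun ℓ ω => if h : ℓ ∈ Finset.Icc 1 M then ω.1 ⟨ℓ, h⟩ else i₀
  let W : ℕ → Fin N → (Finset.Icc 1 M → Fin N) × (Finset.Icc 1 M × Fin N → ℝ) → ℝ :=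
    fun ℓ i ω => if h : ℓ ∈ Finset.Icc 1 M then ω.2 (⟨ℓ, h⟩, i) else 0
  have hJ : ∀ ℓ : Finset.Icc 1 M, J ℓ = fun ω => ω.1 ℓ := fun ℓ => by
    ext ω
    simp only [J, dif_pos ℓ.2]
  have hW : ∀ p : Finset.Icc 1 M × Fin N, W p.1 p.2 = fun ω => ω.2 p := fun p => by
    ext ω
    simp only [W, dif_pos p.1.2]
  have hmapJ : ∀ ℓ : Finset.Icc 1 M, (P₁.prod P₂).map (fun ω => ω.1 ℓ) = μ ℓ := fun ℓ =>
    ((measurePreserving_eval μ ℓ).comp measurePreserving_fst).map_eq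
  have hmapW : ∀ p, (P₁.prod P₂).map (fun ω => ω.2 p) = gaussianReal 0 1 := fun p =>
    ((measurePreserving_eval γ p).comp measurePreserving_snd).map_eq
  refine ⟨_, inferInstance, P₁.prod P₂, inferInstance, J, W, ?_, ?_, ?_, ?_, ?_, ?_, ?_⟩
  · intro ℓ hℓ
    rw [hJ ⟨ℓ, hℓ⟩]
    fun_prop
  · intro ℓ hℓ i
    have := hmapJ ⟨ℓ, hℓ⟩
    rw [← hJ ⟨ℓ, hℓ⟩] at this
    have hm : Measurable (J ℓ) := by
      rw [hJ ⟨ℓ, hℓ⟩]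
      fun_prop
    rw [show {ω | J ℓ ω = i} = J ℓ ⁻¹' {i} from rfl, Measure.real,
      ← Measure.map_apply hm (measurableSet_singleton i), this, hμ,
      ENNReal.toReal_ofReal (hq ℓ hℓ i)]
  · intro ℓ hℓ i
    rw [hW (⟨ℓ, hℓ⟩, i)]
    fun_prop
  · intro ℓ hℓ i
    rw [hW (⟨ℓ, hℓ⟩, i)]
    exact hmapW _
  · simp_rw [hJ]
    rw [iIndepFun_iff_map_fun_eq_pi_map fun ℓ => by fun_prop]
    simp_rw [hmapJ]
    exact measurePreserving_fst.map_eq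
  · simp_rw [hW]
    rw [iIndepFun_iff_map_fun_eq_pi_map fun p => by fun_prop]
    simp_rw [hmapW]
    exact measurePreserving_snd.map_eq
  · simp_rw [hJ, hW]
    exact indepFun_prod measurable_id measurable_id

/-! ### Martingales under an independent time change -/

section TimeChange

variable {Ω U τ : Type*} [mΩ : MeasurableSpace Ω] [mU : MeasurableSpace U] [Preorder τ]

/-- The filtration of a discrete filtration run at the random times `n t`, where the randomisation
`u` is independent and known from the start: an event is known at time `t` if each of its sections
at `u` is known at step `n t u`. -/
def timeChangeFiltration (𝒢 : Filtration ℕ mΩ) (n : τ → U → ℕ) (hn : ∀ u, Monotone (n · u)) :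
    Filtration τ (mΩ.prod mU) where
  seq t := mΩ.prod mU ⊓ ⨅ u, (𝒢 (n t u)).map fun ω => (ω, u)
  mono' _ _ hst := inf_le_inf_left _ (iInf_mono fun u =>
    MeasurableSpace.map_mono (𝒢.mono (hn u hst)))
  le' _ := inf_le_left

lemma measurableSet_timeChangeFiltration {𝒢 : Filtration ℕ mΩ} {n : τ → U → ℕ}
    {hn : ∀ u, Monotone (n · u)} {t : τ} {A : Set (Ω × U)} :
    MeasurableSet[timeChangeFiltration 𝒢 n hn t] A ↔
      MeasurableSet A ∧ ∀ u, MeasurableSet[𝒢 (n t u)] {ω | (ω, u) ∈ A} := by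
  refine MeasurableSpace.measurableSet_inf.trans (and_congr Iff.rfl ?_)
  exact MeasurableSpace.measurableSet_iInf

/-- For fixed `u` the time change is deterministic and non-decreasing, so the martingale identity
holds on the section at `u` of any event known at the earlier time. Fubini then integrates over `u`.
-/
lemma martingale_timeChange {P : Measure Ω} {ν : Measure U} [IsProbabilityMeasure P]
    [IsProbabilityMeasure ν] {𝒢 : Filtration ℕ mΩ} {X : ℕ → Ω → ℝ} (hX : Martingale X 𝒢 P)
    {n : τ → U → ℕ} (hn : ∀ u, Monotone (n · u)) (hmeas : ∀ t, Measurable (n t))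
    {M : ℕ} (hM : ∀ t u, n t u ≤ M) :
    Martingale (fun t (p : Ω × U) => X (n t p.2) p.1) (timeChangeFiltration 𝒢 n hn)
      (P.prod ν) := by
  have hXm : ∀ j, Measurable (X j) := fun j => ((hX.1 j).mono (𝒢.le j)).measurable
  have hZm : ∀ t, Measurable fun p : Ω × U => X (n t p.2) p.1 := fun t =>
    (measurable_from_prod_countable_right (f := fun q : ℕ × Ω => X q.1 q.2) hXm).comp
      (((hmeas t).comp measurable_snd).prodMk measurable_fst)
  have hadapt : ∀ t, StronglyMeasurable[timeChangeFiltration 𝒢 n hn t]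
      fun p : Ω × U => X (n t p.2) p.1 := fun t => by
    refine Measurable.stronglyMeasurable fun s hs => ?_
    exact measurableSet_timeChangeFiltration.2
      ⟨hZm t hs, fun u => (hX.1 (n t u)).measurable hs⟩
  have hZint : ∀ t, Integrable (fun p : Ω × U => X (n t p.2) p.1) (P.prod ν) := fun t => by
    -- As at most `M` steps are made, the finite sum dominates the time-changed process.
    have hsum : Integrable (fun ω => ∑ j ∈ Finset.range (M + 1), |X j ω|) P :=
      integrable_finsetSum _ fun j _ => (hX.integrable j).abs
    refine (hsum.comp_fst ν).mono' (hZm t).aestronglyMeasurable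
      (Eventually.of_forall fun p => ?_)
    exact Finset.single_le_sum (f := fun j => |X j p.1|) (fun j _ => abs_nonneg _)
      (Finset.mem_range.2 (Nat.lt_succ_of_le (hM t p.2)))
  refine ⟨hadapt, fun s t hst => (ae_eq_condExp_of_forall_setIntegral_eq
    ((timeChangeFiltration 𝒢 n hn).le s) (hZint t) (fun _ _ _ => (hZint s).integrableOn) ?_
    (hadapt s).aestronglyMeasurable).symm⟩
  intro A hA _
  obtain ⟨hA, hAu⟩ := measurableSet_timeChangeFiltration.1 hA
  rw [← integral_indicator hA, ← integral_indicator hA,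
    integral_prod_symm _ ((hZint s).indicator hA), integral_prod_symm _ ((hZint t).indicator hA)]
  refine integral_congr_ae (Eventually.of_forall fun u => ?_)
  have hu : MeasurableSet {ω | (ω, u) ∈ A} := 𝒢.le _ _ (hAu u)
  have hind : ∀ r, ∫ ω, A.indicator (fun p : Ω × U => X (n r p.2) p.1) (ω, u) ∂P
      = ∫ ω in {ω | (ω, u) ∈ A}, X (n r u) ω ∂P := fun r => by
    rw [← integral_indicator hu]
    rfl
  dsimp only
  rw [hind, hind]
  exact hX.setIntegral_eq (hn u hst) (hAu u)

end TimeChange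

/-! ### The random clock -/

section Clock

variable {M : ℕ} {T : ℕ → ℝ} {α : ℕ → ℝ → ℝ}

/-- The interpolation weight of period `j`, extended by `0` before and by `1` after it. -/
def clockWeight (T : ℕ → ℝ) (α : ℕ → ℝ → ℝ) (j : ℕ) (t : ℝ) : ℝ :=
  if t < T j then 0 else if T (j + 1) ≤ t then 1 else α j t

/-- The number of steps made at time `t`, given the level `u`: step `j + 1` is made once the weight
of period `j` exceeds `u`. -/
def clock (M : ℕ) (T : ℕ → ℝ) (α : ℕ → ℝ → ℝ) (t u : ℝ) : ℕ :=
  ∑ j ∈ Finset.range M, if u < clockWeight T α j t then 1 else 0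

lemma clock_le (t u : ℝ) : clock M T α t u ≤ M := by
  refine (Finset.sum_le_card_nsmul _ _ 1 fun j _ => ?_).trans (by simp)
  split_ifs <;> simp

lemma measurable_clock (t : ℝ) : Measurable (clock M T α t) :=
  Finset.measurable_fun_sum _ fun _ _ =>
    Measurable.ite measurableSet_Iio measurable_const measurable_const

lemma monotone_clockWeight (hα : ∀ j < M, MonotoneOn (α j) (Set.Icc (T j) (T (j + 1))))
    (hα0 : ∀ j < M, α j (T j) = 0) (hα1 : ∀ j < M, α j (T (j + 1)) = 1) {j : ℕ} (hj : j < M) :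
    Monotone (clockWeight T α j) := by
  intro s t hst
  have hw : ∀ r, T j ≤ r → r ≤ T (j + 1) → α j r ∈ Set.Icc (0 : ℝ) 1 := fun r h1 h2 =>
    weight_mem_Icc hα hα0 hα1 hj h1 h2
  unfold clockWeight
  split_ifs with h1 h2 h3 h4 h5 h6 h7 <;> first | exact le_rfl | exact zero_le_one | skip
  · push Not at h2 h3
    exact (hw t h2 h3.le).1
  · linarith
  · linarith
  · linarith
  · push Not at h1 h4
    exact (hw s h1 h4.le).2
  · push Not at *
    exact hα j hj ⟨h1, by linarith⟩ ⟨by linarith, by linarith⟩ hst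

lemma monotone_clock (hα : ∀ j < M, MonotoneOn (α j) (Set.Icc (T j) (T (j + 1))))
    (hα0 : ∀ j < M, α j (T j) = 0) (hα1 : ∀ j < M, α j (T (j + 1)) = 1) (u : ℝ) :
    Monotone fun t => clock M T α t u := by
  intro s t hst
  refine Finset.sum_le_sum fun j hj => ?_
  have := monotone_clockWeight hα hα0 hα1 (Finset.mem_range.1 hj) hst
  split_ifs with h1 h2
  · exact le_rfl
  · exact absurd (h1.trans_le this) h2
  · exact zero_le_one
  · exact le_rfl

/-- The half-open range of `u` matters: weight `1` always exceeds `u`, and weight `0` never does. -/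
lemma clock_of_weights {t u : ℝ} (hu : u ∈ Ico (0 : ℝ) 1) {j : ℕ} (hj : j ≤ M)
    (h1 : ∀ i < j, clockWeight T α i t = 1) (h0 : ∀ i, j ≤ i → i < M → clockWeight T α i t = 0) :
    clock M T α t u = j := by
  rw [clock, Finset.sum_ite, Finset.sum_const_zero, add_zero, Finset.sum_const, smul_eq_mul,
    mul_one]
  have : (Finset.range M).filter (fun i => u < clockWeight T α i t) = Finset.range j := by
    ext i
    simp only [Finset.mem_filter, Finset.mem_range]
    constructor
    · rintro ⟨hi, h⟩
      by_contra! hij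
      rw [h0 i hij hi] at h
      exact absurd hu.1 (not_le.2 h)
    · intro hi
      exact ⟨by omega, by rw [h1 i hi]; exact hu.2⟩
  rw [this, Finset.card_range]

lemma clock_of_last_le (hT : ∀ j < M, T j < T (j + 1)) {t u : ℝ} (hu : u ∈ Ico (0 : ℝ) 1)
    (ht : T M ≤ t) : clock M T α t u = M := by
  refine clock_of_weights hu le_rfl (fun i hi => ?_) fun i h1 h2 => absurd h1 (by omega)
  have h := (expiry_le hT (i := i + 1) (j := M) hi le_rfl).trans ht
  have := hT i hi
  rw [clockWeight, if_neg (by linarith), if_pos h]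

lemma clock_of_mem_period (hT : ∀ j < M, T j < T (j + 1)) {j : ℕ} (hj : j < M) {t u : ℝ}
    (hu : u ∈ Ico (0 : ℝ) 1) (h1 : T j ≤ t) (h2 : t < T (j + 1)) :
    clock M T α t u = if u < α j t then j + 1 else j := by
  have hlt : ∀ i < j, clockWeight T α i t = 1 := fun i hi => by
    have h := (expiry_le hT (i := i + 1) (j := j) hi hj.le).trans h1
    have := hT i (by omega)
    rw [clockWeight, if_neg (by linarith), if_pos h]
  have hgt : ∀ i, j < i → i < M → clockWeight T α i t = 0 := fun i hi hiM => by
    have h := h2.trans_le (expiry_le hT (i := j + 1) (j := i) hi hiM.le)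
    rw [clockWeight, if_pos h]
  have heq : clockWeight T α j t = α j t := by
    rw [clockWeight, if_neg (not_lt.2 h1), if_neg (not_le.2 h2)]
  have hsplit : clock M T α t u
      = (∑ i ∈ Finset.range j, 1) + ((if u < α j t then 1 else 0)
        + ∑ i ∈ Finset.Ico (j + 1) M, 0) := by
    rw [clock, ← Finset.sum_range_add_sum_Ico _ hj.le, Finset.sum_eq_sum_Ico_succ_bot hj, heq]
    congr 1
    · refine Finset.sum_congr rfl fun i hi => ?_
      rw [hlt i (Finset.mem_range.1 hi), if_pos hu.2]
    · congr 1
      refine Finset.sum_congr rfl fun i hi => ?_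
      rw [hgt i (Finset.mem_Ico.1 hi).1 (Finset.mem_Ico.1 hi).2, if_neg (not_lt.2 hu.1)]
  rw [hsplit]
  split_ifs <;> simp

end Clock

/-! ### Absence of arbitrage -/

lemma integral_Ico_ite_lt {a : ℝ} (ha : a ∈ Set.Icc (0 : ℝ) 1) (x y : ℝ) :
    ∫ u in Ico (0 : ℝ) 1, (if u < a then x else y) = a * x + (1 - a) * y := by
  have h : ∀ u, (if u < a then x else y) = y + (Iio a).indicator (fun _ => x - y) u := by
    intro u
    by_cases hu : u < a <;> simp [hu]
  simp_rw [h]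
  rw [integral_add (integrable_const _)
      ((integrable_const _).indicator measurableSet_Iio),
    integral_indicator measurableSet_Iio, Measure.restrict_restrict measurableSet_Iio,
    setIntegral_const, setIntegral_const, inter_comm, Ico_inter_Iio, min_eq_right ha.2]
  simp only [Real.volume_real_Ico, sub_zero, smul_eq_mul]
  rw [max_eq_left zero_le_one, max_eq_left ha.1]
  ring

/-- The martingale is the product process run by the clock at a uniform level. In period `j` it sits
at step `j + 1` with probability `α j t` and at step `j` otherwise, which is the interpolation. -/
lemma arbitrageFree_surface {K : Fin N → ℝ} {q dV : ℕ → Fin N → ℝ} {M : ℕ} {T : ℕ → ℝ}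
    {α : ℕ → ℝ → ℝ} (hM : 1 ≤ M) (hK0 : ∀ i, 0 < K i) (hT0 : T 0 = 0)
    (hT : ∀ j < M, T j < T (j + 1))
    (hα : ∀ j < M, MonotoneOn (α j) (Set.Icc (T j) (T (j + 1))))
    (hα0 : ∀ j < M, α j (T j) = 0) (hα1 : ∀ j < M, α j (T (j + 1)) = 1)
    (hdV : ∀ j ∈ Finset.Icc 1 M, ∀ i, 0 ≤ dV j i)
    (hq : ∀ j ∈ Finset.Icc 1 M, ∀ i, 0 ≤ q j i) (hq_sum : ∀ j ∈ Finset.Icc 1 M, ∑ i, q j i = 1)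
    (hq_mean : ∀ j ∈ Finset.Icc 1 M, ∑ i, q j i * K i = 1) :
    ArbitrageFree (surface M T α K q dV) := by
  obtain ⟨Ω, mΩ, P, hP, J, W, h⟩ := exists_isDriver hM hq hq_sum
  let ν : Measure ℝ := volume.restrict (Ico 0 1)
  have hν : IsProbabilityMeasure ν := ⟨by simp [ν]⟩
  have hνmem : ∀ᵐ u ∂ν, u ∈ Ico (0 : ℝ) 1 := ae_restrict_mem measurableSet_Ico
  let n : ℝ≥0 → ℝ → ℕ := fun t u => clock M T α t u
  have hn : ∀ u, Monotone (n · u) := fun u =>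
    (monotone_clock hα hα0 hα1 u).comp NNReal.coe_mono
  have hmart := martingale_timeChange (ν := ν) (h.martingale hK0 hdV hq hq_mean) hn
    (fun t => measurable_clock (t : ℝ)) (fun t u => clock_le (M := M) (t : ℝ) u)
  refine ⟨Ω × ℝ, inferInstance, P.prod ν, inferInstance, _, _, hmart, ?_, ?_, ?_⟩
  · exact fun t => Eventually.of_forall fun p => productProcess_pos hK0 _ _
  · filter_upwards [Measure.quasiMeasurePreserving_snd.ae hνmem] with p hp
    -- At time zero the weight vanishes, so no level `u ≥ 0` has triggered a step and the process
    -- starts at one.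
    have hα00 : α 0 0 = 0 := by simpa only [hT0] using hα0 0 hM
    have h0 : n 0 p.2 = 0 := by
      simp only [n, NNReal.coe_zero]
      rw [clock_of_mem_period hT hM hp hT0.le (hT0 ▸ hT 0 hM), hα00,
        if_neg (not_lt.2 hp.1)]
    rw [h0, Nat.zero_min, productProcess_zero]
  · intro t k hk
    have hint : Integrable (fun p : Ω × ℝ =>
        max (productProcess K dV J W (min (n t p.2) M) p.1 - k) 0) (P.prod ν) :=
      ((hmart.integrable t).sub (integrable_const k)).pos_part
    -- With `u` held fixed, the inner expectation is the slice at the step shown by the clock.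
    rw [integral_prod_symm _ hint]
    simp_rw [h.integral_call hK0 hdV hq (min_le_right _ M) hk]
    have hnM : ∀ u, min (n t u) M = n t u := fun u => min_eq_left (clock_le _ _)
    simp_rw [hnM]
    rcases lt_or_ge (t : ℝ) (T M) with htM | htM
    · obtain ⟨j, hj, h1, h2⟩ := exists_period hT (hT0 ▸ t.2) htM
      rw [surface_of_mem_period hT hj h1 h2]
      beta_reduce
      rw [← integral_Ico_ite_lt (weight_mem_Icc hα hα0 hα1 hj h1 h2.le)]
      refine (setIntegral_congr_fun measurableSet_Ico fun u hu => ?_).symm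
      simp only [n]
      rw [clock_of_mem_period hT hj hu h1 h2]
      split_ifs <;> rfl
    · rw [surface_of_last_le hT htM]
      have hconst : ∀ᵐ u ∂ν, CTilde K q dV (n t u) k = CTilde K q dV M k := by
        filter_upwards [hνmem] with u hu
        simp only [n]
        rw [clock_of_last_le hT hu htM]
      rw [integral_congr_ae hconst]
      simp

end SmoothCalls

end

theorem mainTheorem4 {N M : ℕ} (hM : 1 ≤ M)
    (K : Fin N → ℝ) (hK0 : ∀ i, 0 < K i) (hK : StrictMono K)
    (T : ℕ → ℝ) (hT0 : T 0 = 0) (hT : ∀ j < M, T j < T (j + 1))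
    (α : ℕ → ℝ → ℝ)
    (hα : ∀ j < M, MonotoneOn (α j) (Set.Icc (T j) (T (j + 1))))
    (hα0 : ∀ j < M, α j (T j) = 0) (hα1 : ∀ j < M, α j (T (j + 1)) = 1)
    (dV : ℕ → Fin N → ℝ) (hdV : ∀ j ∈ Finset.Icc 1 M, ∀ i, 0 ≤ dV j i)
    (q : ℕ → Fin N → ℝ) (hq : ∀ j ∈ Finset.Icc 1 M, ∀ i, 0 ≤ q j i)
    (hq_sum : ∀ j ∈ Finset.Icc 1 M, ∑ i, q j i = 1)
    (hq_mean : ∀ j ∈ Finset.Icc 1 M, ∑ i, q j i * K i = 1) :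
    -- the surface is arbitrage-free
    SmoothCalls.ArbitrageFree (SmoothCalls.surface M T α K q dV) ∧
    -- it is smooth in strike at all positive times
    ((∃ i, 0 < q 1 i ∧ 0 < dV 1 i) →
      ∀ t, 0 < t → (t < T 1 → 0 < α 0 t) →
        SmoothCalls.SmoothInStrike (SmoothCalls.surface M T α K q dV t)) ∧
    ((∀ i, 0 < q 1 i → 0 < dV 1 i) →
      ∀ t, T 1 ≤ t → ContDiffOn ℝ (⊤ : ℕ∞) (SmoothCalls.surface M T α K q dV t) (Set.Ioi 0)) ∧
    -- the slices are realised by the product process, a positive martingale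
    (∃ (Ω : Type) (_ : MeasurableSpace Ω) (P : Measure Ω) (_ : IsProbabilityMeasure P)
      (J : ℕ → Ω → Fin N) (W : ℕ → Fin N → Ω → ℝ), SmoothCalls.IsDriver M q P J W) ∧
    (∀ (Ω : Type*) [MeasurableSpace Ω] (P : Measure Ω) [IsProbabilityMeasure P]
      (J : ℕ → Ω → Fin N) (W : ℕ → Fin N → Ω → ℝ), SmoothCalls.IsDriver M q P J W →
      (∀ j ω, 0 < SmoothCalls.productProcess K dV J W j ω) ∧
      (∃ ℱ : Filtration (Fin (M + 1)) ‹MeasurableSpace Ω›,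
        Martingale (fun j : Fin (M + 1) => SmoothCalls.productProcess K dV J W j) ℱ P) ∧
      ∀ j ≤ M, ∀ k, 0 ≤ k →
        SmoothCalls.CTilde K q dV j k
          = ∫ ω, max (SmoothCalls.productProcess K dV J W j ω - k) 0 ∂P) := by
  exact ⟨SmoothCalls.arbitrageFree_surface hM hK0 hT0 hT hα hα0 hα1 hdV hq hq_sum hq_mean,
    fun hpos _ ht ht1 =>
      SmoothCalls.smoothInStrike_surface hM hK0 hT0 hT hα hα0 hα1 hdV hq hq_sum hpos ht ht1,
    fun hpos _ ht => SmoothCalls.contDiffOn_surface hM hK0 hT hdV hq hpos ht,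
    SmoothCalls.exists_isDriver hM hq hq_sum,
    fun _ _ _ _ _ _ h => ⟨SmoothCalls.productProcess_pos hK0,
      h.exists_martingale_fin hK0 hdV hq hq_mean,
      fun _ hj _ hk => (h.integral_call hK0 hdV hq hj hk).symm⟩⟩
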